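/- Let $p>1$ and $1<\rho<\frac{2}{p-1}$ (so that $1<p<3$), and write $\langle x\rangle=(1+|x|^2)^{1/2}$. For $t\in\mathbb R$, $x\in\mathbb R$ put $$S(t)f(x)=\frac{e^{-t/2}}{2}\int_{-t}^{t}I_0\Big(\frac{\sqrt{t^2-y^2}}{2}\Big)f(x-y)\,dy,$$ where $I_0$ is the modified Bessel function of the first kind of order $0$, and let $\partial_tS(t)f(x)$ be its derivative in $t$. A mild solution of $$\partial_t^2u+\partial_tu-\Delta u+u^p=0\ \text{ in }(0,\infty)\times\mathbb R,\qquad u(0)=u_0,\quad \partial_tu(0)=u_1,$$ is a measurable function $u\ge 0$ on $[0,\infty)\times\mathbb R$ with $u^p$ locally integrable on $[0,\infty)\times\mathbb R$ such that, for every $t\ge0$, $$u(t,x)=S(t)(u_0+u_1)(x)+\partial_tS(t)u_0(x)-\int_0^tS(t-\tau)u^p(\tau)(x)\,d\tau\quad\text{for a.e. }x\in\mathbb R.$$ Then there are $\varepsilon_0>0$ and $C>0$, depending only on $p$ and $\rho$, such that the following holds for every $0<\varepsilon\le\varepsilon_0$. Let $u_0\in W^{1,1}(\mathbb R)\cap W^{1,\infty}(\mathbb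 R)$ and $u_1\in L^1(\mathbb R)\cap L^\infty(\mathbb R)$ satisfy $$0\le u_0(x)\le\varepsilon\langle x\rangle^{-\rho},\qquad 0\le u_1(x)+\tfrac12u_0(x)\le\varepsilon\langle x\rangle^{-\rho}\qquad\text{for a.e. }x\in\mathbb R .$$ Then every mild solution $u$ satisfies $$\|u(t)\|_{L^q(\mathbb R)}\le C\,t^{\frac{1}{q\rho(p-1)}-\frac{1}{p-1}}\qquad\text{for all }t>0\text{ and all }q\in[1,\infty]$$ (with $1/q=0$ for $q=\infty$; in particular $u(t)\in L^q(\mathbb R)$). Moreover $u\in L^p(0,\infty;L^p(\mathbb R))$. -/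

import Mathlib

open MeasureTheory

namespace DampedWave

/-- The modified Bessel function of the first kind of order zero,
`I₀(x) = ∑ₖ (x/2)^(2k) / (k!)²`. -/
noncomputable def besselI0 (x : ℝ) : ℝ :=
  ∑' k : ℕ, (x / 2) ^ (2 * k) / ((k.factorial : ℝ) ^ 2)

/-- The solution operator of the linear damped wave equation on the line,
`S(t) f(x) = (e^{-t/2} / 2) ∫_{-t}^{t} I₀(√(t² - y²) / 2) f(x - y) dy`.
The formula also makes sense for `t < 0`, with an oriented integral. -/
noncomputable def S (t : ℝ) (f : ℝ → ℝ) (x : ℝ) : ℝ :=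
  Real.exp (-t / 2) / 2 *
    ∫ y in (-t)..t, besselI0 (Real.sqrt (t ^ 2 - y ^ 2) / 2) * f (x - y)

/-- `∂ₜ S(t) f(x)`, the pointwise time derivative of `S(t) f(x)`. For continuous `f` the function
`t ↦ S(t) f(x)` is continuously differentiable, with derivative `f(x)` at `t = 0`. -/
noncomputable def dtS (t : ℝ) (f : ℝ → ℝ) (x : ℝ) : ℝ :=
  deriv (fun s : ℝ => S s f x) t

/-- `g` is the weak derivative of `f` on the line. -/
def HasWeakDeriv (f g : ℝ → ℝ) : Prop :=
  ∀ φ : ℝ → ℝ, ContDiff ℝ (⊤ : ℕ∞) φ → HasCompactSupport φ →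
    ∫ x, f x * deriv φ x = -∫ x, g x * φ x

/-- The Sobolev space `W^{1,r}(ℝ)`. -/
def MemW1 (f : ℝ → ℝ) (r : ENNReal) : Prop :=
  MemLp f r volume ∧ ∃ g : ℝ → ℝ, MemLp g r volume ∧ HasWeakDeriv f g

/-- `u` (of which only the values at times `t ≥ 0` matter) is a global mild solution to
`∂ₜ²u + ∂ₜu - Δu + u^p = 0`, `u(0) = u₀`, `∂ₜu(0) = u₁` : it is non-negative and satisfies
`u(t) = S(t)(u₀ + u₁) + ∂ₜS(t) u₀ - ∫₀ᵗ S(t - τ) u(τ)^p dτ` at every time `t ≥ 0`,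
almost everywhere in space. Measurability and local integrability of `u^p` on `[0,∞) × ℝ` are the
minimal requirements that give the integral its meaning. -/
structure IsMildSolution (p : ℝ) (u₀ u₁ : ℝ → ℝ) (u : ℝ → ℝ → ℝ) : Prop where
  measurable : AEStronglyMeasurable (fun z : ℝ × ℝ => u z.1 z.2)
    ((volume.restrict (Set.Ici (0 : ℝ))).prod volume)
  nonneg : ∀ t : ℝ, 0 ≤ t → ∀ᵐ x : ℝ, 0 ≤ u t x
  locallyIntegrable : ∀ T R : ℝ, IntegrableOn (fun z : ℝ × ℝ => u z.1 z.2 ^ p)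
    (Set.Icc 0 T ×ˢ Set.Icc (-R) R) volume
  integral_eq : ∀ t : ℝ, 0 ≤ t → ∀ᵐ x : ℝ,
    u t x = S t (fun y => u₀ y + u₁ y) x + dtS t u₀ x
      - ∫ τ in (0 : ℝ)..t, S (t - τ) (fun y => u τ y ^ p) x

/-- The Japanese bracket `⟨x⟩ = (1 + |x|²)^{1/2}`. -/
noncomputable def bracket (x : ℝ) : ℝ := Real.sqrt (1 + |x| ^ 2)

end DampedWave

/-!
For small data the solution lies below an explicit supersolution of the nonlinear equation, and the
estimates are read off from it.

*Barrier.* Put `γ = 1 / (p - 1)`, `m = ρ (p - 1) ∈ (p - 1, 2)` and `c = (p - 1) / 2`. The function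
`V(t, x) = ((Q + x²)^{m/2} + c t)^{-γ}` solves the ordinary differential equation `∂ₜV = -V^p / 2`,
its second time derivative is positive, and because `m < 2` the term `∂ₓ²V` is at most `V^p / 2`
once `Q` is large; so `∂ₜ²V + ∂ₜV - ∂ₓ²V + V^p ≥ 0`. Small data lie below `V` at time zero. From
`V ≤ C t^{-γ}` and `∫ V(t, x) dx ≤ C t^{1/m - γ}` the `L^q` bounds follow by interpolation, and
`∫₀^∞ V^p dt = 2 V(0, x)` is integrable because `m γ = ρ > 1`.

*Comparison.* The kernel of `S` is positive, but the nonlinearity enters with the wrong sign for a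
comparison in the formulation with `S`. With `v = e^{t/2} u` the equation reads
`∂ₜ²v - ∂ₓ²v = v / 4 - e^{t/2} u^p`, whose right-hand side is increasing in `u` as long as `u` is
small, and d'Alembert's kernel is positive as well. Since `r ↦ r / 4 - r^p` need only be monotone
below the values of `V`, no smallness of `u` is required: `M = (e^{t/2} (u - V))⁺` satisfies
`M ≤ (1 / 4) w ⋆ M` with d'Alembert's kernel `w`, hence vanishes
(`comparison`, `ae_eq_zero_of_le_waveKernel_lconvolution`).

*From `S` to d'Alembert's kernel.* The kernel `k = e^{t/2} S` satisfies `k = w + (1 / 4) w ⋆ k`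
(`telegraphKernel_eq`), a termwise integration of the Bessel series in light-cone coordinates.
Convolving the mild formulation with `w` then gives the formulation for the wave equation
(`wave_duhamel`). All convolutions are taken in `ℝ≥0∞`, so that Tonelli's theorem applies freely;
finiteness is only needed where a term is cancelled.

*The term `∂ₜS(t) u₀`.* For `t > 0` and almost every `x` the derivative exists by Lebesgue's
differentiation theorem, because `k(t) * u₀` is the time integral of
`φ + (1 / 4) k ⋆ φ` with `φ(t, x) = (u₀(x + t) + u₀(x - t)) / 2` (`ae_hasDerivAt_S`).
-/

namespace DampedWave

open Set Filter Topology ENNReal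

/-! ### The kernel of the damped wave equation -/

/-- The Riemann function of the telegraph equation, `J(z) = I₀(√z / 2)` for `z ≥ 0`, written as the
power series that makes it entire. -/
noncomputable def riemannFun (z : ℝ) : ℝ := ∑' n : ℕ, (z / 16) ^ n / ((n.factorial : ℝ) ^ 2)

lemma norm_riemannFun_term_le {x R : ℝ} (h : |x| ≤ R) (n : ℕ) :
    ‖(x / 16) ^ n / ((n.factorial : ℝ) ^ 2)‖ ≤ (R / 16) ^ n / n.factorial := by
  have h1 : (1 : ℝ) ≤ n.factorial := by exact_mod_cast n.factorial_pos
  rw [norm_div, norm_pow, norm_pow, Real.norm_natCast, Real.norm_eq_abs, abs_div,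
    abs_of_pos (by norm_num : (0 : ℝ) < 16)]
  have h2 : (n.factorial : ℝ) ≤ (n.factorial : ℝ) ^ 2 := by nlinarith
  have h3 := (abs_nonneg x).trans h
  gcongr

lemma summable_riemannFun (z : ℝ) :
    Summable fun n : ℕ => (z / 16) ^ n / ((n.factorial : ℝ) ^ 2) :=
  Summable.of_norm_bounded (Real.summable_pow_div_factorial (|z| / 16))
    (norm_riemannFun_term_le le_rfl)

lemma continuous_riemannFun : Continuous riemannFun := by
  rw [continuous_iff_continuousAt]
  intro z
  have h : ContinuousOn riemannFun (Metric.ball 0 (|z| + 1)) :=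
    continuousOn_tsum (fun n => by fun_prop)
      (Real.summable_pow_div_factorial ((|z| + 1) / 16)) fun n x hx =>
        norm_riemannFun_term_le (by simpa using (mem_ball_zero_iff.1 hx).le) n
  exact h.continuousAt (Metric.isOpen_ball.mem_nhds (by simp))

lemma riemannFun_mono {a b : ℝ} (ha : 0 ≤ a) (hab : a ≤ b) : riemannFun a ≤ riemannFun b :=
  (summable_riemannFun a).tsum_le_tsum (fun n => by gcongr) (summable_riemannFun b)

lemma riemannFun_nonneg {a : ℝ} (ha : 0 ≤ a) : 0 ≤ riemannFun a :=
  tsum_nonneg fun n => by positivity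

lemma besselI0_sqrt {z : ℝ} (hz : 0 ≤ z) : besselI0 (√z / 2) = riemannFun z := by
  unfold besselI0 riemannFun
  congr 1 with n
  rw [pow_mul, div_div, div_pow, Real.sq_sqrt hz]
  norm_num

lemma ofReal_riemannFun {z : ℝ} (hz : 0 ≤ z) :
    ENNReal.ofReal (riemannFun z / 2) =
      ∑' n : ℕ, ENNReal.ofReal ((z / 16) ^ n / ((n.factorial : ℝ) ^ 2) / 2) := by
  rw [riemannFun, ← tsum_div_const,
    ENNReal.ofReal_tsum_of_nonneg (fun n => by positivity) ((summable_riemannFun z).div_const 2)]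

/-- The kernel `k(t, x) = I₀(√(t² - x²) / 2) / 2` on the open forward cone `|x| < t`, extended by
zero. It is the kernel of `e^{t/2} S(t)` and the fundamental solution of `∂ₜ² - ∂ₓ² - 1/4`. -/
noncomputable def telegraphKernel (z : ℝ × ℝ) : ℝ≥0∞ :=
  if |z.2| < z.1 then ENNReal.ofReal (riemannFun (z.1 ^ 2 - z.2 ^ 2) / 2) else 0

/-- d'Alembert's kernel, the fundamental solution of `∂ₜ² - ∂ₓ²`. -/
noncomputable def waveKernel (z : ℝ × ℝ) : ℝ≥0∞ := if |z.2| < z.1 then 1 / 2 else 0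

lemma measurableSet_cone : MeasurableSet {z : ℝ × ℝ | |z.2| < z.1} :=
  measurableSet_lt (by fun_prop) (by fun_prop)

@[fun_prop]
lemma measurable_telegraphKernel : Measurable telegraphKernel :=
  Measurable.ite measurableSet_cone
    (by have := continuous_riemannFun.measurable; fun_prop) measurable_const

@[fun_prop]
lemma measurable_waveKernel : Measurable waveKernel :=
  Measurable.ite measurableSet_cone measurable_const measurable_const

lemma lintegral_comp_half (G : ℝ → ℝ≥0∞) (hG : Measurable G) :
    ∫⁻ b, G (b / 2) = 2 * ∫⁻ b, G b := by
  have h := Real.map_volume_mul_right (a := (1 / 2 : ℝ)) (by norm_num)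
  have h2 := lintegral_map (μ := volume) hG (measurable_mul_const (1 / 2 : ℝ))
  rw [h, lintegral_smul_measure] at h2
  norm_num at h2
  rw [h2]
  simp_rw [div_eq_mul_inv, one_mul]

/-- Change of variables to the light-cone coordinates `a = t + x`, `b = t - x`. -/
lemma lintegral_lightCone {F : ℝ × ℝ → ℝ≥0∞} (hF : Measurable F) :
    ∫⁻ z, F z = 1 / 2 * ∫⁻ a, ∫⁻ b, F ((a + b) / 2, (a - b) / 2) := by
  rw [Measure.volume_eq_prod, lintegral_prod _ hF.aemeasurable]
  have h1 : ∀ t, ∫⁻ x, F (t, x) = ∫⁻ a, F (t, a - t) := fun t =>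
    (lintegral_sub_right_eq_self (fun x => F (t, x)) t).symm
  simp_rw [h1]
  rw [lintegral_lintegral_swap (by fun_prop), ← lintegral_const_mul' _ _ (by norm_num)]
  congr 1 with a
  have h2 : ∫⁻ b, F ((a + b) / 2, (a - b) / 2) = 2 * ∫⁻ b, F (b, a - b) := by
    have e1 : ∀ b, ((a + b) / 2, (a - b) / 2) = (b / 2 + a / 2, a / 2 - b / 2) := fun b =>
      Prod.ext (by ring) (by ring)
    have e2 : ∀ b, (b + a / 2, a - (b + a / 2)) = (b + a / 2, a / 2 - b) := fun b =>
      Prod.ext rfl (by ring)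
    rw [← lintegral_add_right_eq_self (fun b => F (b, a - b)) (a / 2)]
    simp_rw [e1, e2]
    exact lintegral_comp_half (fun b => F (b + a / 2, a / 2 - b)) (by fun_prop)
  rw [h2, ← mul_assoc, one_div, ENNReal.inv_mul_cancel (by norm_num) (by norm_num), one_mul]

/-- In light-cone coordinates, convolution with d'Alembert's kernel is integration over a quadrant.
-/
lemma waveKernel_lconvolution {F : ℝ × ℝ → ℝ≥0∞} (hF : Measurable F) (t x : ℝ) :
    (waveKernel ⋆ₗ F) (t, x) =
      1 / 4 * ∫⁻ a in Iio (t + x), ∫⁻ b in Iio (t - x), F ((a + b) / 2, (a - b) / 2) := by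
  rw [lconvolution_comm, lconvolution_def, lintegral_lightCone (by fun_prop)]
  have : (1 / 4 : ℝ≥0∞) = 1 / 2 * (1 / 2) := by
    rw [one_div, one_div, ← ENNReal.mul_inv (by simp) (by simp)]; norm_num
  rw [this, mul_assoc]
  congr 1
  rw [← lintegral_indicator measurableSet_Iio,
    ← lintegral_const_mul' _ _ (by norm_num)]
  refine lintegral_congr fun a => ?_
  rw [indicator]
  split_ifs with ha
  · rw [← lintegral_indicator measurableSet_Iio, ← lintegral_const_mul' _ _ (by norm_num)]
    congr 1 with b
    rw [indicator, waveKernel]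
    have : |(-((a + b) / 2, (a - b) / 2) + (t, x) : ℝ × ℝ).2| <
      (-((a + b) / 2, (a - b) / 2) + (t, x) : ℝ × ℝ).1 ↔ b ∈ Iio (t - x) := by
      simp only [mem_Iio, abs_lt, Prod.fst_add, Prod.snd_add, Prod.fst_neg, Prod.snd_neg] at *
      constructor
      · intro h; linarith [h.1]
      · intro h; constructor <;> linarith
    simp only [this]
    split_ifs <;> simp [mul_comm]
  · rw [mul_zero, lintegral_eq_zero_of_ae_eq_zero]
    refine Eventually.of_forall fun b => ?_
    have : ¬ |(-((a + b) / 2, (a - b) / 2) + (t, x) : ℝ × ℝ).2| <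
      (-((a + b) / 2, (a - b) / 2) + (t, x) : ℝ × ℝ).1 := by
      simp only [mem_Iio, abs_lt, Prod.fst_add, Prod.snd_add, Prod.fst_neg, Prod.snd_neg] at *
      intro h
      linarith [h.2]
    simp only [waveKernel]
    rw [if_neg this, mul_zero, Pi.zero_apply]

lemma lintegral_pow_Ioo {B : ℝ} (hB : 0 ≤ B) (n : ℕ) :
    ∫⁻ b in Ioo 0 B, ENNReal.ofReal (b ^ n) = ENNReal.ofReal (B ^ (n + 1) / (n + 1)) := by
  rw [← ofReal_integral_eq_lintegral_ofReal]
  · rw [← integral_Ioc_eq_integral_Ioo, ← intervalIntegral.integral_of_le hB, integral_pow]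
    simp
  · exact ((continuous_pow n).integrableOn_Icc (a := 0) (b := B)).mono_set Ioo_subset_Icc_self
  · filter_upwards [ae_restrict_mem measurableSet_Ioo] with b hb
    exact pow_nonneg hb.1.le n

lemma telegraphKernel_lightCone (a b : ℝ) : telegraphKernel ((a + b) / 2, (a - b) / 2) =
    (Ioi (0 : ℝ)).indicator (fun a => (Ioi (0 : ℝ)).indicator
      (fun b => ENNReal.ofReal (riemannFun (a * b) / 2)) b) a := by
  have : |(a - b) / 2| < (a + b) / 2 ↔ 0 < a ∧ 0 < b := by
    rw [abs_lt]
    constructor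
    · rintro ⟨h1, h2⟩; constructor <;> linarith
    · rintro ⟨h1, h2⟩; constructor <;> linarith
  have h2 : ((a + b) / 2) ^ 2 - ((a - b) / 2) ^ 2 = a * b := by ring
  simp only [telegraphKernel, this, h2, indicator, mem_Ioi]
  split_ifs <;> simp_all

/-- The resolvent identity between the two kernels. In light-cone coordinates it reads
`J(AB) = 1 + (1 / 16) ∫₀ᴬ ∫₀ᴮ J(ab) db da`. -/
lemma telegraphKernel_eq :
    telegraphKernel = waveKernel + (1 / 4 : ℝ≥0∞) • (waveKernel ⋆ₗ telegraphKernel) := by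
  ext ⟨t, x⟩
  simp only [Pi.add_apply, Pi.smul_apply, smul_eq_mul]
  rw [waveKernel_lconvolution measurable_telegraphKernel]
  simp_rw [telegraphKernel_lightCone]
  by_cases h : |x| < t
  · set A := t + x with hA
    set B := t - x with hB
    have hA0 : 0 < A := by linarith [(abs_lt.1 h).1]
    have hB0 : 0 < B := by linarith [(abs_lt.1 h).2]
    have h1 : ∫⁻ a in Iio A, ∫⁻ b in Iio B, (Ioi (0 : ℝ)).indicator (fun a =>
        (Ioi (0 : ℝ)).indicator (fun b => ENNReal.ofReal (riemannFun (a * b) / 2)) b) a =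
        ∫⁻ a in Ioo 0 A, ∫⁻ b in Ioo 0 B, ENNReal.ofReal (riemannFun (a * b) / 2) := by
      rw [← Ioi_inter_Iio, ← setLIntegral_indicator measurableSet_Ioi]
      congr 1 with a
      by_cases ha : 0 < a
      · simp only [indicator, mem_Ioi, ha, if_true]
        rw [← Ioi_inter_Iio, ← setLIntegral_indicator measurableSet_Ioi]
        rfl
      · simp [ha]
    have h2 : ∀ n : ℕ, ∫⁻ a in Ioo 0 A, ∫⁻ b in Ioo 0 B,
        ENNReal.ofReal ((a * b / 16) ^ n / ((n.factorial : ℝ) ^ 2) / 2) =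
        16 * ENNReal.ofReal ((A * B / 16) ^ (n + 1) / (((n + 1).factorial : ℝ) ^ 2) / 2) := by
      intro n
      have e : ∀ a ∈ Ioo 0 A, ∀ b ∈ Ioo 0 B,
          ENNReal.ofReal ((a * b / 16) ^ n / ((n.factorial : ℝ) ^ 2) / 2) =
          ENNReal.ofReal (1 / 16 ^ n / ((n.factorial : ℝ) ^ 2) / 2) * ENNReal.ofReal (a ^ n) *
            ENNReal.ofReal (b ^ n) := by
        intro a ha b hb
        have := ha.1; have := hb.1
        rw [← ENNReal.ofReal_mul (by positivity), ← ENNReal.ofReal_mul (by positivity)]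
        congr 1
        rw [div_pow, mul_pow]
        ring
      rw [setLIntegral_congr_fun measurableSet_Ioo (fun a ha =>
        setLIntegral_congr_fun measurableSet_Ioo (fun b hb => e a ha b hb))]
      simp_rw [lintegral_const_mul' _ _ (ENNReal.mul_ne_top ENNReal.ofReal_ne_top
        ENNReal.ofReal_ne_top), lintegral_pow_Ioo hB0.le]
      rw [lintegral_mul_const' _ _ ENNReal.ofReal_ne_top,
        lintegral_const_mul' _ _ ENNReal.ofReal_ne_top, lintegral_pow_Ioo hA0.le,
        ← ENNReal.ofReal_mul (by positivity), ← ENNReal.ofReal_mul (by positivity),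
        show (16 : ℝ≥0∞) = ENNReal.ofReal 16 by norm_num, ← ENNReal.ofReal_mul (by positivity)]
      congr 1
      rw [Nat.factorial_succ, div_pow (A * B), mul_pow A]
      push_cast
      field_simp
      ring
    rw [h1]
    have h3 : ∫⁻ a in Ioo 0 A, ∫⁻ b in Ioo 0 B, ENNReal.ofReal (riemannFun (a * b) / 2) =
        ∑' n : ℕ, 16 *
          ENNReal.ofReal ((A * B / 16) ^ (n + 1) / (((n + 1).factorial : ℝ) ^ 2) / 2) := by
      rw [setLIntegral_congr_fun measurableSet_Ioo (fun a ha =>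
        setLIntegral_congr_fun measurableSet_Ioo (fun b hb =>
          ofReal_riemannFun (mul_nonneg (le_of_lt ha.1) (le_of_lt hb.1))))]
      simp_rw [← h2]
      rw [← lintegral_tsum (fun n => by fun_prop)]
      congr 1 with a
      rw [lintegral_tsum (fun n => by fun_prop)]
    have h4 : t ^ 2 - x ^ 2 = A * B := by rw [hA, hB]; ring
    rw [h3, ENNReal.tsum_mul_left, telegraphKernel, waveKernel, if_pos h, if_pos h, h4,
      ofReal_riemannFun (by positivity), tsum_eq_zero_add' ENNReal.summable, ← mul_assoc,
      ← mul_assoc]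
    congr 1
    · simp [ENNReal.ofReal_inv_of_pos]
    · have : (1 / 4 : ℝ≥0∞) * (1 / 4) * 16 = 1 := by
        rw [one_div, ← ENNReal.mul_inv (by simp) (by simp)]; norm_num
        exact ENNReal.inv_mul_cancel (by norm_num) (by norm_num)
      rw [this, one_mul]
  · have h1 : ∫⁻ a in Iio (t + x), ∫⁻ b in Iio (t - x), (Ioi (0 : ℝ)).indicator (fun a =>
        (Ioi (0 : ℝ)).indicator (fun b => ENNReal.ofReal (riemannFun (a * b) / 2)) b) a = 0 := by
      rw [lintegral_eq_zero_of_ae_eq_zero]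
      filter_upwards [ae_restrict_mem measurableSet_Iio] with a ha
      rw [Pi.zero_apply, lintegral_eq_zero_of_ae_eq_zero]
      filter_upwards [ae_restrict_mem measurableSet_Iio] with b hb
      simp only [indicator, mem_Ioi, mem_Iio, Pi.zero_apply] at *
      split_ifs with h1 h2 <;> try rfl
      exact absurd (abs_lt.2 ⟨by linarith, by linarith⟩) h
    simp [telegraphKernel, waveKernel, h, h1]

/-! ### Convolutions with the kernels and with initial data -/

section Convolution

variable {G : Type*} [AddGroup G] [MeasurableSpace G]

lemma lconvolution_add_right [MeasurableAdd₂ G] [MeasurableNeg G] {μ : Measure G}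
    (f : G → ℝ≥0∞) {g h : G → ℝ≥0∞} (hf : Measurable f) (hg : Measurable g) :
    f ⋆ₗ[μ] (g + h) = f ⋆ₗ[μ] g + f ⋆ₗ[μ] h := by
  ext z
  simp only [lconvolution_def, Pi.add_apply, mul_add]
  exact lintegral_add_left (by fun_prop) _

lemma lconvolution_smul_right {μ : Measure G} (f g : G → ℝ≥0∞) {c : ℝ≥0∞} (hc : c ≠ ∞) :
    f ⋆ₗ[μ] (c • g) = c • (f ⋆ₗ[μ] g) := by
  ext z
  simp only [lconvolution_def, Pi.smul_apply, smul_eq_mul, ← lintegral_const_mul' _ _ hc]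
  exact lintegral_congr fun y => by ring

end Convolution

/-- The convolution in space `∫ k(t, x - y) g(y) dy`, that is, the convolution in space-time of `k`
with initial data `g` placed on `{t = 0}`. -/
noncomputable def dataConv (k : ℝ × ℝ → ℝ≥0∞) (g : ℝ → ℝ≥0∞) (z : ℝ × ℝ) : ℝ≥0∞ :=
  ∫⁻ y, k (z.1, z.2 - y) * g y

@[fun_prop]
lemma measurable_dataConv {k : ℝ × ℝ → ℝ≥0∞} {g : ℝ → ℝ≥0∞} (hk : Measurable k)
    (hg : Measurable g) : Measurable (dataConv k g) := by
  unfold dataConv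
  fun_prop

lemma lconvolution_dataConv {h k : ℝ × ℝ → ℝ≥0∞} {g : ℝ → ℝ≥0∞} (hh : Measurable h)
    (hk : Measurable k) (hg : Measurable g) :
    h ⋆ₗ dataConv k g = dataConv (h ⋆ₗ k) g := by
  ext z
  simp only [lconvolution_def, dataConv]
  have h1 : ∀ y : ℝ × ℝ, h y * ∫⁻ w, k ((-y + z).1, (-y + z).2 - w) * g w =
      ∫⁻ w, h y * (k ((-y + z).1, (-y + z).2 - w) * g w) := fun y =>
    (lintegral_const_mul _ (by fun_prop)).symm
  simp_rw [h1]
  rw [lintegral_lintegral_swap (by fun_prop)]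
  refine lintegral_congr fun y => ?_
  rw [← lintegral_mul_const _ (by fun_prop)]
  refine lintegral_congr fun w => ?_
  rw [mul_assoc]
  congr 3
  exact Prod.ext rfl (add_sub_assoc _ _ _)

lemma dataConv_add_smul {h k : ℝ × ℝ → ℝ≥0∞} {g : ℝ → ℝ≥0∞} {c : ℝ≥0∞} (hc : c ≠ ∞)
    (hh : Measurable h) (hg : Measurable g) :
    dataConv (h + c • k) g = dataConv h g + c • dataConv k g := by
  ext z
  simp only [dataConv, Pi.add_apply, Pi.smul_apply, smul_eq_mul, add_mul]
  rw [lintegral_add_left (by fun_prop), ← lintegral_const_mul' _ _ hc]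
  simp_rw [mul_assoc]

lemma telegraphKernel_lconvolution {F : ℝ × ℝ → ℝ≥0∞} (hF : Measurable F) :
    telegraphKernel ⋆ₗ F =
      waveKernel ⋆ₗ F + (1 / 4 : ℝ≥0∞) • (waveKernel ⋆ₗ (telegraphKernel ⋆ₗ F)) := by
  have hw := measurable_waveKernel
  have hk := measurable_telegraphKernel
  conv_lhs => rw [telegraphKernel_eq]
  rw [lconvolution_comm, lconvolution_add_right _ hF hw, lconvolution_smul_right _ _ (by norm_num),
    lconvolution_comm (f := F), lconvolution_comm (f := F), lconvolution_assoc hw hk hF]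

lemma dataConv_telegraphKernel {g : ℝ → ℝ≥0∞} (hg : Measurable g) :
    dataConv telegraphKernel g = dataConv waveKernel g +
      (1 / 4 : ℝ≥0∞) • (waveKernel ⋆ₗ dataConv telegraphKernel g) := by
  have hw := measurable_waveKernel
  conv_lhs => rw [telegraphKernel_eq]
  rw [dataConv_add_smul (by norm_num) hw hg,
    lconvolution_dataConv hw measurable_telegraphKernel hg]

/-- The solution `(g(x - t) + g(x + t)) / 2` of the wave equation with initial value `g` and initial
velocity zero, cut off to positive times. -/
noncomputable def waveData (g : ℝ → ℝ≥0∞) (z : ℝ × ℝ) : ℝ≥0∞ :=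
  if 0 < z.1 then 1 / 2 * (g (z.2 - z.1) + g (z.2 + z.1)) else 0

@[fun_prop]
lemma measurable_waveData {g : ℝ → ℝ≥0∞} (hg : Measurable g) : Measurable (waveData g) :=
  Measurable.ite (measurableSet_lt (by fun_prop) (by fun_prop)) (by fun_prop) measurable_const

/-- `φ + (1 / 4) k ⋆ φ` for `φ = waveData g`: the solution of `∂ₜ²v - ∂ₓ²v = v / 4` with initial
value `g` and initial velocity zero. -/
noncomputable def telegraphData (g : ℝ → ℝ≥0∞) : ℝ × ℝ → ℝ≥0∞ :=
  waveData g + (1 / 4 : ℝ≥0∞) • (telegraphKernel ⋆ₗ waveData g)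

@[fun_prop]
lemma measurable_telegraphData {g : ℝ → ℝ≥0∞} (hg : Measurable g) :
    Measurable (telegraphData g) := by
  unfold telegraphData
  have := measurable_lconvolution volume measurable_telegraphKernel (measurable_waveData hg)
  exact (measurable_waveData hg).add (this.const_smul _)

lemma telegraphData_eq {g : ℝ → ℝ≥0∞} (hg : Measurable g) :
    telegraphData g = waveData g + (1 / 4 : ℝ≥0∞) • (waveKernel ⋆ₗ telegraphData g) := by
  have hw := measurable_waveKernel
  conv_rhs => rw [telegraphData, lconvolution_add_right _ hw (measurable_waveData hg),
    lconvolution_smul_right _ _ (by norm_num),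
    ← telegraphKernel_lconvolution (measurable_waveData hg)]
  rfl

/-- The time integral of the wave with initial value `g` is the wave with initial velocity `g`. -/
lemma lintegral_waveData {g : ℝ → ℝ≥0∞} (hg : Measurable g) (s x : ℝ) :
    ∫⁻ r in Iio s, waveData g (r, x) = dataConv waveKernel g (s, x) := by
  have h1 : dataConv waveKernel g (s, x) = ∫⁻ y, waveKernel (s, y) * g (x - y) := by
    rw [dataConv, ← lintegral_sub_left_eq_self _ x]
    simp
  have h2 : ∀ᵐ y : ℝ, waveKernel (s, y) * g (x - y) =
      (Ioo 0 s).indicator (fun y => 1 / 2 * g (x - y)) y +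
      (Ioo 0 s).indicator (fun y => 1 / 2 * g (x + y)) (-y) := by
    filter_upwards [compl_mem_ae_iff.2 (measure_singleton (0 : ℝ))] with y hy
    have hy : y ≠ 0 := hy
    simp only [waveKernel, indicator, mem_Ioo, abs_lt]
    rcases hy.lt_or_gt with h | h
    · by_cases h' : -s < y
      · rw [if_pos ⟨h', by linarith⟩, if_neg (by intro h; linarith [h.1]),
          if_pos ⟨by linarith, by linarith⟩, zero_add, sub_eq_add_neg]
      · rw [if_neg (fun h => h' h.1), if_neg (by intro h; linarith [h.1]),
          if_neg (by intro h; exact h' (by linarith [h.2])), zero_mul, zero_add]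
    · by_cases h' : y < s
      · rw [if_pos ⟨by linarith, h'⟩, if_pos ⟨h, h'⟩, if_neg (by intro h; linarith [h.1]),
          add_zero]
      · rw [if_neg (fun h => h' h.2), if_neg (fun h => h' h.2),
          if_neg (by intro h; linarith [h.1]), zero_mul, zero_add]
  rw [h1, lintegral_congr_ae h2, lintegral_add_left
    (Measurable.indicator (by fun_prop) measurableSet_Ioo), lintegral_neg_eq_self,
    ← lintegral_add_left (Measurable.indicator (by fun_prop) measurableSet_Ioo),
    ← lintegral_indicator measurableSet_Iio]
  refine lintegral_congr fun r => ?_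
  simp only [waveData, indicator, mem_Ioo, mem_Iio]
  split_ifs <;> simp_all [mul_add]

/-- Integration in time up to `s` commutes with convolution in space-time. -/
lemma lintegral_lconvolution_time {k F : ℝ × ℝ → ℝ≥0∞} (hk : Measurable k) (hF : Measurable F)
    (s x : ℝ) : ∫⁻ r in Iio s, (k ⋆ₗ F) (r, x) =
      (k ⋆ₗ fun z => ∫⁻ r in Iio z.1, F (r, z.2)) (s, x) := by
  simp only [lconvolution_def]
  rw [lintegral_lintegral_swap (by fun_prop)]
  refine lintegral_congr fun y => ?_
  rw [lintegral_const_mul _ (by fun_prop), ← lintegral_indicator measurableSet_Iio,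
    ← lintegral_indicator measurableSet_Iio]
  congr 1
  conv_rhs => rw [← lintegral_sub_right_eq_self _ y.1]
  refine lintegral_congr fun r => ?_
  simp only [indicator, mem_Iio, Prod.fst_add, Prod.fst_neg, Prod.snd_add, Prod.snd_neg]
  have : (r - y.1 < -y.1 + s) ↔ r < s := by constructor <;> intro h <;> linarith
  simp only [this]
  have e : (-y + (r, x) : ℝ × ℝ) = (r - y.1, -y.2 + x) :=
    Prod.ext (by rw [sub_eq_neg_add]; rfl) rfl
  rw [e]

/-- The function `k(s) * g` as a time integral. Together with `lintegral_waveData` it says that the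
time derivative of `k(s) * g` is `telegraphData g`. -/
lemma dataConv_telegraphKernel_eq_lintegral {g : ℝ → ℝ≥0∞} (hg : Measurable g) (s x : ℝ) :
    dataConv telegraphKernel g (s, x) = dataConv waveKernel g (s, x) +
      1 / 4 * ∫⁻ r in Iio s, (telegraphKernel ⋆ₗ waveData g) (r, x) := by
  have hw := measurable_waveKernel
  have hk := measurable_telegraphKernel
  rw [lintegral_lconvolution_time hk (measurable_waveData hg)]
  simp_rw [lintegral_waveData hg]
  have := congrFun (lconvolution_dataConv hk hw hg) (s, x)
  change _ = _ + _ * (telegraphKernel ⋆ₗ dataConv waveKernel g) (s, x)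
  rw [this, lconvolution_comm, ← lconvolution_dataConv hw hk hg]
  exact congrFun (dataConv_telegraphKernel hg) (s, x)

lemma telegraphKernel_le {T : ℝ} {z : ℝ × ℝ} (hz : z.1 ≤ T) :
    telegraphKernel z ≤ ENNReal.ofReal (riemannFun (T ^ 2) / 2) := by
  rw [telegraphKernel]
  split_ifs with h
  · refine ENNReal.ofReal_le_ofReal ?_
    have h1 : z.2 ^ 2 ≤ z.1 ^ 2 := sq_le_sq.2 (h.le.trans (le_abs_self _))
    have h2 := (abs_nonneg _).trans h.le
    gcongr
    refine riemannFun_mono (by linarith) ?_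
    nlinarith [sq_nonneg z.2]
  · exact zero_le

/-- Finite speed of propagation, with a crude bound for the kernel. -/
lemma telegraphKernel_lconvolution_le {F : ℝ × ℝ → ℝ≥0∞}
    (hF0 : ∀ z : ℝ × ℝ, z.1 ≤ 0 → F z = 0) (t x : ℝ) :
    (telegraphKernel ⋆ₗ F) (t, x) ≤ ENNReal.ofReal (riemannFun (t ^ 2) / 2) *
      ∫⁻ z in Icc 0 t ×ˢ Icc (x - t) (x + t), F z := by
  rw [lconvolution_comm, lconvolution_def,
    ← lintegral_indicator (measurableSet_Icc.prod measurableSet_Icc),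
    ← lintegral_const_mul' _ _ ENNReal.ofReal_ne_top]
  refine lintegral_mono fun y => ?_
  by_cases h0 : y.1 ≤ 0
  · simp [hF0 y h0]
  by_cases hc : |x - y.2| < t - y.1
  · rw [indicator_of_mem]
    · rw [mul_comm]
      gcongr
      exact telegraphKernel_le (by simp; linarith)
    · have := abs_lt.1 hc
      simp only [mem_prod, mem_Icc]
      refine ⟨⟨by linarith, by linarith [abs_nonneg (x - y.2)]⟩, by linarith, by linarith⟩
  · have : telegraphKernel (-y + (t, x)) = 0 := by
      rw [telegraphKernel, if_neg]
      simpa [← sub_eq_neg_add] using hc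
    simp [this]

lemma dataConv_telegraphKernel_le (g : ℝ → ℝ≥0∞) (t x : ℝ) :
    dataConv telegraphKernel g (t, x) ≤ ENNReal.ofReal (riemannFun (t ^ 2) / 2) *
      ∫⁻ y in Icc (x - t) (x + t), g y := by
  rw [dataConv, ← lintegral_indicator measurableSet_Icc,
    ← lintegral_const_mul' _ _ ENNReal.ofReal_ne_top]
  refine lintegral_mono fun y => ?_
  by_cases hc : |x - y| < t
  · rw [indicator_of_mem]
    · gcongr
      exact telegraphKernel_le le_rfl
    · have := abs_lt.1 hc
      exact ⟨by linarith, by linarith⟩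
  · simp [telegraphKernel, hc]

/-! ### The operator `S` and its time derivative -/

lemma S_congr_ae {f g : ℝ → ℝ} (h : f =ᵐ[volume] g) (t x : ℝ) : S t f x = S t g x := by
  unfold S
  congr 1
  refine intervalIntegral.integral_congr_ae ?_
  have := (quasiMeasurePreserving_sub_left volume x).ae_eq_comp h
  filter_upwards [this] with y hy _
  simp only [Function.comp] at hy
  rw [hy]

lemma dtS_congr_ae {f g : ℝ → ℝ} (h : f =ᵐ[volume] g) (t x : ℝ) : dtS t f x = dtS t g x := by
  unfold dtS
  simp_rw [S_congr_ae h]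

lemma intervalIntegrable_S {f : ℝ → ℝ} (hf : LocallyIntegrable f) (t x : ℝ) :
    IntervalIntegrable (fun y => besselI0 (√(t ^ 2 - y ^ 2) / 2) * f (x - y)) volume (-t) t := by
  have h1 : IntervalIntegrable (fun y => f (x - y)) volume (-t) t := by
    have := hf.integrableOn_isCompact (isCompact_uIcc (a := x - -t) (b := x - t))
    simpa using this.intervalIntegrable.comp_sub_left x
  refine h1.continuousOn_mul ?_
  refine ContinuousOn.congr (f := fun y => riemannFun (t ^ 2 - y ^ 2))
    (continuous_riemannFun.comp (by fun_prop)).continuousOn fun y hy => ?_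
  refine besselI0_sqrt (sub_nonneg.2 (sq_le_sq.2 ?_))
  rw [uIcc_comm] at hy
  rcases le_total 0 t with h | h
  · rw [uIcc_of_ge (by linarith)] at hy
    rw [abs_of_nonneg h]
    exact abs_le.2 ⟨by linarith [hy.1], by linarith [hy.2]⟩
  · rw [uIcc_of_le (by linarith)] at hy
    rw [abs_of_nonpos h]
    exact abs_le.2 ⟨by linarith [hy.1], by linarith [hy.2]⟩

lemma S_add {f g : ℝ → ℝ} (hf : LocallyIntegrable f) (hg : LocallyIntegrable g) (t x : ℝ) :
    S t (fun y => f y + g y) x = S t f x + S t g x := by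
  unfold S
  rw [← mul_add, ← intervalIntegral.integral_add (intervalIntegrable_S hf t x)
    (intervalIntegrable_S hg t x)]
  simp_rw [mul_add]

lemma S_div_two (f : ℝ → ℝ) (t x : ℝ) : S t (fun y => f y / 2) x = S t f x / 2 := by
  unfold S
  simp_rw [← mul_div_assoc]
  rw [intervalIntegral.integral_div]
  ring

lemma S_eq_dataConv {f : ℝ → ℝ} (hf : AEStronglyMeasurable f) (hf0 : 0 ≤ᵐ[volume] f) {t : ℝ}
    (ht : 0 ≤ t) (x : ℝ) : S t f x = Real.exp (-t / 2) *
      (dataConv telegraphKernel (fun y => ENNReal.ofReal (f y)) (t, x)).toReal := by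
  have hq := quasiMeasurePreserving_sub_left (volume : Measure ℝ) x
  have hf0' : ∀ᵐ y : ℝ, 0 ≤ f (x - y) := hq.ae hf0
  have hfm : AEStronglyMeasurable (fun y => f (x - y)) volume :=
    hf.comp_quasiMeasurePreserving hq
  have hJ := continuous_riemannFun
  unfold S
  rw [intervalIntegral.integral_of_le (by linarith), integral_Ioc_eq_integral_Ioo,
    setIntegral_congr_fun (g := fun y => riemannFun (t ^ 2 - y ^ 2) * f (x - y)) measurableSet_Ioo,
    integral_eq_lintegral_of_nonneg_ae, div_mul_eq_mul_div, mul_div_assoc]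
  · congr 1
    have h1 : dataConv telegraphKernel (fun y => ENNReal.ofReal (f y)) (t, x) =
        1 / 2 * ∫⁻ y in Ioo (-t) t, ENNReal.ofReal (riemannFun (t ^ 2 - y ^ 2) * f (x - y)) := by
      rw [dataConv, ← lintegral_sub_left_eq_self _ x, ← lintegral_indicator measurableSet_Ioo,
        ← lintegral_const_mul' _ _ (by norm_num)]
      refine lintegral_congr fun y => ?_
      simp only [_root_.sub_sub_cancel]
      simp only [telegraphKernel, indicator, mem_Ioo, abs_lt]
      split_ifs with h
      · have : 0 ≤ riemannFun (t ^ 2 - y ^ 2) :=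
          riemannFun_nonneg (sub_nonneg.2 (sq_le_sq.2 ((abs_lt.2 h).le.trans (le_abs_self t))))
        rw [ENNReal.ofReal_div_of_pos (by norm_num), ENNReal.ofReal_mul this,
          ENNReal.div_eq_inv_mul, mul_assoc]
        simp
      · simp
    rw [h1, ENNReal.toReal_mul]
    simp
    ring
  · filter_upwards [ae_restrict_mem measurableSet_Ioo, ae_restrict_of_ae hf0'] with y hy h0
    exact mul_nonneg (riemannFun_nonneg (by nlinarith [hy.1, hy.2])) h0
  · exact ((hJ.comp (by fun_prop : Continuous fun y : ℝ => t ^ 2 - y ^ 2)).aestronglyMeasurable.mul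
      hfm).restrict
  · intro y hy
    simp only
    rw [besselI0_sqrt (by nlinarith [hy.1, hy.2])]

lemma lconvolution_ne_top {F : ℝ × ℝ → ℝ≥0∞} (hF0 : ∀ z : ℝ × ℝ, z.1 ≤ 0 → F z = 0) {N : ℝ≥0∞}
    (hN : N ≠ ∞) {t : ℝ} (hFN : ∀ z : ℝ × ℝ, z.1 ≤ t → F z ≤ N) (x : ℝ) :
    (telegraphKernel ⋆ₗ F) (t, x) ≠ ∞ := by
  refine ne_top_of_le_ne_top ?_ (telegraphKernel_lconvolution_le hF0 t x)
  refine ENNReal.mul_ne_top ENNReal.ofReal_ne_top (ne_top_of_le_ne_top ?_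
    (setLIntegral_mono' (measurableSet_Icc.prod measurableSet_Icc) fun z hz => hFN z hz.1.2))
  rw [lintegral_const, Measure.restrict_apply_univ]
  exact ENNReal.mul_ne_top hN (isCompact_Icc.prod isCompact_Icc).measure_lt_top.ne

lemma ae_notMem_lightCone (t x : ℝ) : ∀ᵐ y : ℝ × ℝ, |x - y.2| ≠ t - y.1 := by
  rw [Measure.volume_eq_prod, Measure.ae_prod_iff_ae_ae]
  · refine Eventually.of_forall fun τ => ?_
    have : ({x - (t - τ), x + (t - τ)} : Set ℝ).Countable := (Set.toFinite _).countable
    filter_upwards [this.ae_notMem volume] with y hy h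
    apply hy
    rcases abs_choice (x - y) with h' | h' <;> rw [h'] at h
    · left; linarith
    · right; exact show y = _ by linarith
  · exact (measurableSet_eq_fun (by fun_prop) (by fun_prop)).compl

/-- Continuity in time of `k ⋆ F` for a bounded `F`, by dominated convergence: the kernel is only
discontinuous on the boundary of the cone, which is a null set. -/
lemma continuousAt_lconvolution {F : ℝ × ℝ → ℝ≥0∞} (hF : Measurable F)
    (hF0 : ∀ z : ℝ × ℝ, z.1 ≤ 0 → F z = 0) {N : ℝ≥0∞} (hN : N ≠ ∞) (hFN : ∀ z, F z ≤ N)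
    (t x : ℝ) : ContinuousAt (fun r => (telegraphKernel ⋆ₗ F) (r, x)) t := by
  simp_rw [lconvolution_comm (f := telegraphKernel), lconvolution_def]
  set C := ENNReal.ofReal (riemannFun ((t + 1) ^ 2) / 2)
  set B : Set (ℝ × ℝ) := Icc 0 (t + 1) ×ˢ Icc (x - (t + 1)) (x + (t + 1))
  refine tendsto_lintegral_filter_of_dominated_convergence (B.indicator fun _ => N * C)
    (Eventually.of_forall fun r => by fun_prop) ?_ ?_ ?_
  · filter_upwards [Iio_mem_nhds (show t < t + 1 by linarith)] with r hr
    refine Eventually.of_forall fun y => ?_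
    by_cases h0 : y.1 ≤ 0
    · simp [hF0 y h0]
    by_cases hc : |x - y.2| < r - y.1
    · rw [indicator_of_mem]
      · gcongr
        · exact hFN y
        · exact telegraphKernel_le (by simp at *; linarith)
      · have := abs_lt.1 hc
        simp only [mem_Iio] at hr
        simp only [B, mem_prod, mem_Icc]
        refine ⟨⟨by linarith, by linarith [abs_nonneg (x - y.2)]⟩, by linarith, by linarith⟩
    · have : telegraphKernel (-y + (r, x)) = 0 := by
        rw [telegraphKernel, if_neg]
        simpa [← sub_eq_neg_add] using hc
      simp [this]
  · rw [lintegral_indicator (measurableSet_Icc.prod measurableSet_Icc), lintegral_const,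
      Measure.restrict_apply_univ]
    exact ENNReal.mul_ne_top (ENNReal.mul_ne_top hN ENNReal.ofReal_ne_top)
      (isCompact_Icc.prod isCompact_Icc).measure_lt_top.ne
  · filter_upwards [ae_notMem_lightCone t x] with y hy
    refine ENNReal.Tendsto.const_mul ?_ (Or.inr (ne_top_of_le_ne_top hN (hFN y)))
    have hJ := continuous_riemannFun
    rcases hy.lt_or_gt with h | h
    · have h1 : ∀ᶠ r in 𝓝 t, |x - y.2| < r - y.1 :=
        (by fun_prop : Continuous fun r : ℝ => r - y.1).continuousAt.eventually
          (Ioi_mem_nhds h)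
      have h2 : Continuous fun r : ℝ =>
          ENNReal.ofReal (riemannFun ((r - y.1) ^ 2 - (x - y.2) ^ 2) / 2) :=
        ENNReal.continuous_ofReal.comp (by fun_prop)
      have h3 : ∀ r, |x - y.2| < r - y.1 → telegraphKernel (-y + (r, x)) =
          ENNReal.ofReal (riemannFun ((r - y.1) ^ 2 - (x - y.2) ^ 2) / 2) := by
        intro r hr
        have : |(-y + (r, x)).2| < (-y + (r, x)).1 := by simpa [← sub_eq_neg_add] using hr
        rw [telegraphKernel, if_pos this]
        simp [← sub_eq_neg_add]
      rw [h3 t h]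
      refine (h2.tendsto t).congr' ?_
      filter_upwards [h1] with r hr
      rw [h3 r hr]
    · have h1 : ∀ᶠ r in 𝓝 t, r - y.1 < |x - y.2| :=
        (by fun_prop : Continuous fun r : ℝ => r - y.1).continuousAt.eventually
          (Iio_mem_nhds h)
      have h3 : ∀ r, r - y.1 < |x - y.2| → telegraphKernel (-y + (r, x)) = 0 := by
        intro r hr
        rw [telegraphKernel, if_neg]
        simpa [← sub_eq_neg_add] using hr.le
      rw [h3 t h]
      refine tendsto_const_nhds.congr' ?_
      filter_upwards [h1] with r hr
      rw [h3 r hr]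

lemma waveData_eq_zero (g : ℝ → ℝ≥0∞) (z : ℝ × ℝ) (hz : z.1 ≤ 0) : waveData g z = 0 := by
  rw [waveData, if_neg hz.not_gt]

lemma waveData_le {g : ℝ → ℝ≥0∞} {N : ℝ≥0∞} (hg : ∀ y, g y ≤ N) (z : ℝ × ℝ) :
    waveData g z ≤ N := by
  rw [waveData]
  split_ifs
  · calc 1 / 2 * (g (z.2 - z.1) + g (z.2 + z.1)) ≤ 1 / 2 * (N + N) := by
          gcongr <;> exact hg _
      _ = N := by
          rw [← two_mul, ← mul_assoc, one_div, ENNReal.inv_mul_cancel (by simp) (by simp), one_mul]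
  · exact zero_le

lemma telegraphData_ne_top {g : ℝ → ℝ≥0∞} {N : ℝ≥0∞} (hN : N ≠ ∞) (hg : ∀ y, g y ≤ N)
    (t x : ℝ) : telegraphData g (t, x) ≠ ∞ :=
  ENNReal.add_ne_top.2 ⟨ne_top_of_le_ne_top hN (waveData_le hg _), ENNReal.mul_ne_top (by norm_num)
    (lconvolution_ne_top (waveData_eq_zero g) hN (fun z _ => waveData_le hg z) x)⟩

lemma toReal_dataConv_waveKernel {f : ℝ → ℝ} (hf : LocallyIntegrable f) (hf0 : ∀ y, 0 ≤ f y)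
    {s : ℝ} (hs : 0 ≤ s) (x : ℝ) :
    (dataConv waveKernel (fun y => ENNReal.ofReal (f y)) (s, x)).toReal =
      (1 / 2) * ∫ y in (x - s)..(x + s), f y := by
  have h1 : dataConv waveKernel (fun y => ENNReal.ofReal (f y)) (s, x) =
      1 / 2 * ∫⁻ y in Ioo (x - s) (x + s), ENNReal.ofReal (f y) := by
    rw [dataConv, ← lintegral_indicator measurableSet_Ioo, ← lintegral_const_mul' _ _ (by norm_num)]
    refine lintegral_congr fun y => ?_
    have : |x - y| < s ↔ x - s < y ∧ y < x + s := by
      rw [abs_lt]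
      constructor <;> rintro ⟨h1, h2⟩ <;> constructor <;> linarith
    simp only [waveKernel, this, indicator, mem_Ioo]
    split_ifs <;> simp
  rw [h1, ENNReal.toReal_mul, intervalIntegral.integral_of_le (by linarith),
    integral_Ioc_eq_integral_Ioo, integral_eq_lintegral_of_nonneg_ae
      (Eventually.of_forall hf0) hf.aestronglyMeasurable.restrict]
  simp

/-- For bounded measurable data the pointwise time derivative of `S(t) f(x)` exists at each `t > 0`
for almost every `x`, namely where `x + t` and `x - t` are Lebesgue points of `f`. -/
lemma ae_hasDerivAt_S {f : ℝ → ℝ} (hf : Measurable f) (hf0 : ∀ y, 0 ≤ f y) {M : ℝ}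
    (hfM : ∀ y, f y ≤ M) {t : ℝ} (ht : 0 < t) : ∀ᵐ x : ℝ, HasDerivAt (fun s => S s f x)
      (-(S t f x / 2) + Real.exp (-t / 2) *
        (telegraphData (fun y => ENNReal.ofReal (f y)) (t, x)).toReal) t := by
  set F : ℝ → ℝ≥0∞ := fun y => ENNReal.ofReal (f y) with hF
  have hFm : Measurable F := by fun_prop
  have hFN : ∀ y, F y ≤ ENNReal.ofReal M := fun y => ENNReal.ofReal_le_ofReal (hfM y)
  have hloc : LocallyIntegrable f := by
    refine (locallyIntegrable_const M).mono hf.aestronglyMeasurable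
      (Eventually.of_forall fun y => ?_)
    rw [Real.norm_of_nonneg (hf0 y)]
    exact (hfM y).trans (le_abs_self M)
  have hae := LocallyIntegrable.ae_hasDerivAt_integral hloc
  have hp : ∀ᵐ x : ℝ, ∀ c, HasDerivAt (fun x => ∫ y in c..x, f y) (f (x + t)) (x + t) :=
    (quasiMeasurePreserving_add_right volume t).ae hae
  have hm : ∀ᵐ x : ℝ, ∀ c, HasDerivAt (fun x => ∫ y in c..x, f y) (f (x - t)) (x - t) := by
    simpa only [← sub_eq_add_neg] using (quasiMeasurePreserving_add_right volume (-t)).ae hae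
  filter_upwards [hp, hm] with x hxp hxm
  have hfin : ∀ r, (telegraphKernel ⋆ₗ waveData F) (r, x) ≠ ∞ := fun r =>
    lconvolution_ne_top (waveData_eq_zero F) ENNReal.ofReal_ne_top (fun z _ => waveData_le hFN z) x
  have hcont : Continuous fun r => ((telegraphKernel ⋆ₗ waveData F) (r, x)).toReal := by
    rw [continuous_iff_continuousAt]
    intro r
    exact (ENNReal.tendsto_toReal (hfin r)).comp (continuousAt_lconvolution
      (measurable_waveData hFm) (waveData_eq_zero F) ENNReal.ofReal_ne_top (waveData_le hFN) r x)
  have hmeas : Measurable fun r => (telegraphKernel ⋆ₗ waveData F) (r, x) :=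
    (measurable_lconvolution volume measurable_telegraphKernel
      (measurable_waveData hFm)).comp (by fun_prop)
  have hS : ∀ s, 0 ≤ s → S s f x = Real.exp (-s / 2) * ((1 / 2) * ((∫ y in x..(x + s), f y) -
      ∫ y in x..(x - s), f y) +
      1 / 4 * ∫ r in 0..s, ((telegraphKernel ⋆ₗ waveData F) (r, x)).toReal) := by
    intro s hs
    have h1 : (∫⁻ r in Iio s, (telegraphKernel ⋆ₗ waveData F) (r, x)).toReal =
        ∫ r in 0..s, ((telegraphKernel ⋆ₗ waveData F) (r, x)).toReal := by
      rw [intervalIntegral.integral_of_le hs, integral_Ioc_eq_integral_Ioo,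
        integral_toReal hmeas.aemeasurable (Eventually.of_forall fun r => (hfin r).lt_top),
        ← Ioi_inter_Iio, ← setLIntegral_indicator measurableSet_Ioi]
      congr 1
      refine lintegral_congr fun r => ?_
      by_cases hr : 0 < r
      · rw [indicator_of_mem (mem_Ioi.2 hr)]
      · rw [indicator_of_notMem (by simpa using hr)]
        have := telegraphKernel_lconvolution_le (waveData_eq_zero F) r x
        rcases (not_lt.1 hr).lt_or_eq with hr | rfl
        · simpa [hr] using this
        · rw [setLIntegral_measure_zero, mul_zero] at this
          · exact nonpos_iff_eq_zero.1 this
          · rw [Measure.volume_eq_prod, Measure.prod_prod]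
            simp
    have h2 : dataConv telegraphKernel F (s, x) ≠ ∞ := by
      refine ne_top_of_le_ne_top ?_ (dataConv_telegraphKernel_le F s x)
      refine ENNReal.mul_ne_top ENNReal.ofReal_ne_top
        (ne_top_of_le_ne_top ?_ (lintegral_mono fun z => hFN z))
      rw [lintegral_const, Measure.restrict_apply_univ]
      exact ENNReal.mul_ne_top ENNReal.ofReal_ne_top isCompact_Icc.measure_lt_top.ne
    rw [dataConv_telegraphKernel_eq_lintegral hFm] at h2
    obtain ⟨hdf, hkf⟩ := ENNReal.add_ne_top.1 h2
    rw [S_eq_dataConv hf.aestronglyMeasurable (Eventually.of_forall hf0) hs,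
      dataConv_telegraphKernel_eq_lintegral hFm, ENNReal.toReal_add hdf hkf,
      ENNReal.toReal_mul, h1, toReal_dataConv_waveKernel hloc hf0 hs,
      intervalIntegral.integral_interval_sub_left]
    · norm_num
    · exact (hloc.integrableOn_isCompact isCompact_uIcc).intervalIntegrable
    · exact (hloc.integrableOn_isCompact isCompact_uIcc).intervalIntegrable
  have hd : HasDerivAt (fun s => Real.exp (-s / 2) * ((1 / 2) * ((∫ y in x..(x + s), f y) -
      ∫ y in x..(x - s), f y) +
      1 / 4 * ∫ r in 0..s, ((telegraphKernel ⋆ₗ waveData F) (r, x)).toReal))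
      (Real.exp (-t / 2) * (-1 / 2) * ((1 / 2) * ((∫ y in x..(x + t), f y) -
      ∫ y in x..(x - t), f y) +
      1 / 4 * ∫ r in 0..t, ((telegraphKernel ⋆ₗ waveData F) (r, x)).toReal) +
      Real.exp (-t / 2) * ((1 / 2) * (f (x + t) * 1 - f (x - t) * (-1)) +
        1 / 4 * ((telegraphKernel ⋆ₗ waveData F) (t, x)).toReal)) t := by
    refine HasDerivAt.mul ?_ (HasDerivAt.add (HasDerivAt.const_mul _ (HasDerivAt.sub ?_ ?_))
      (HasDerivAt.const_mul _ ?_))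
    · exact (((hasDerivAt_id t).neg.div_const 2)).exp
    · exact HasDerivAt.comp t (hxp x) ((hasDerivAt_id t).const_add x)
    · exact HasDerivAt.comp t (hxm x) ((hasDerivAt_id t).const_sub x)
    · exact hcont.integral_hasStrictDerivAt 0 t |>.hasDerivAt
  have hd2 := hd.congr_of_eventuallyEq (f₁ := fun s => S s f x) (by
    filter_upwards [Ioi_mem_nhds ht] with s hs
    exact hS s (le_of_lt hs))
  refine hd2.congr_deriv ?_
  rw [hS t ht.le, telegraphData, Pi.add_apply, Pi.smul_apply, smul_eq_mul,
    ENNReal.toReal_add (ne_top_of_le_ne_top ENNReal.ofReal_ne_top (waveData_le hFN _))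
      (ENNReal.mul_ne_top (by norm_num) (hfin t)), ENNReal.toReal_mul, waveData, if_pos ht,
    ENNReal.toReal_mul, ENNReal.toReal_add ENNReal.ofReal_ne_top ENNReal.ofReal_ne_top,
    ENNReal.toReal_ofReal (hf0 _), ENNReal.toReal_ofReal (hf0 _)]
  norm_num
  ring

/-! ### The mild formulation with the telegraph kernel -/

/-- A mild solution has a representative that is measurable and nonnegative everywhere. -/
lemma IsMildSolution.exists_measurable {p : ℝ} {u₀ u₁ : ℝ → ℝ} {u : ℝ → ℝ → ℝ}
    (hu : IsMildSolution p u₀ u₁ u) : ∃ U : ℝ × ℝ → ℝ, Measurable U ∧ (∀ z, 0 ≤ U z) ∧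
      (fun z : ℝ × ℝ => u z.1 z.2) =ᵐ[(volume.restrict (Ici (0 : ℝ))).prod volume] U := by
  have hm := hu.measurable.stronglyMeasurable_mk.measurable
  have hae := hu.measurable.ae_eq_mk
  set w := hu.measurable.mk
  refine ⟨fun z => max 0 (w z), by fun_prop, fun z => le_max_left _ _, hae.trans ?_⟩
  have h1 : ∀ᵐ z ∂(volume.restrict (Ici (0 : ℝ))).prod volume, 0 ≤ w z := by
    rw [Measure.ae_prod_iff_ae_ae (measurableSet_le measurable_const hm)]
    filter_upwards [Measure.ae_ae_of_ae_prod hae, ae_restrict_mem measurableSet_Ici] with t h1 h2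
    filter_upwards [h1, hu.nonneg t h2] with x h3 h4
    rwa [← h3]
  filter_upwards [h1] with z hz
  exact (max_eq_right hz).symm

/-- The source term `e^{t/2} U^p` at positive times, extended by zero. With `p = 1` it is the
function `e^{t/2} U` itself. -/
noncomputable def source (p : ℝ) (U : ℝ × ℝ → ℝ) (z : ℝ × ℝ) : ℝ≥0∞ :=
  if 0 < z.1 then ENNReal.ofReal (Real.exp (z.1 / 2) * U z ^ p) else 0

@[fun_prop]
lemma measurable_source {p : ℝ} {U : ℝ × ℝ → ℝ} (hU : Measurable U) : Measurable (source p U) :=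
  Measurable.ite (measurableSet_lt (by fun_prop) (by fun_prop)) (by fun_prop) measurable_const

lemma source_eq_zero (p : ℝ) (U : ℝ × ℝ → ℝ) (z : ℝ × ℝ) (hz : z.1 ≤ 0) : source p U z = 0 := by
  rw [source, if_neg hz.not_gt]

lemma IsMildSolution.lconvolution_source_ne_top {p : ℝ} {u₀ u₁ : ℝ → ℝ} {u : ℝ → ℝ → ℝ}
    (hu : IsMildSolution p u₀ u₁ u) {U : ℝ × ℝ → ℝ}
    (hUu : (fun z : ℝ × ℝ => u z.1 z.2) =ᵐ[(volume.restrict (Ici (0 : ℝ))).prod volume] U)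
    (t x : ℝ) : (telegraphKernel ⋆ₗ source p U) (t, x) ≠ ∞ := by
  refine ne_top_of_le_ne_top ?_ (telegraphKernel_lconvolution_le (source_eq_zero p U) t x)
  refine ENNReal.mul_ne_top ENNReal.ofReal_ne_top ?_
  -- a symmetric interval that contains the base of the backward cone
  set R := |x| + |t|
  have hsub : Icc (x - t) (x + t) ⊆ Icc (-R) R := by
    refine Icc_subset_Icc ?_ ?_
    · linarith [neg_abs_le x, le_abs_self t]
    · linarith [le_abs_self x, le_abs_self t]
  have h1 := hu.locallyIntegrable t R
  have h2 : ∀ᵐ z ∂(volume.restrict (Icc 0 t ×ˢ Icc (-R) R)), u z.1 z.2 = U z := by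
    have : volume.restrict (Icc 0 t ×ˢ Icc (-R) R) ≤
        (volume.restrict (Ici (0 : ℝ))).prod (volume : Measure ℝ) := by
      rw [Measure.volume_eq_prod, ← Measure.prod_restrict]
      exact Measure.prod_mono (Measure.restrict_mono Icc_subset_Ici_self le_rfl)
        Measure.restrict_le_self
    exact ae_mono this hUu
  refine ne_top_of_le_ne_top ?_ (lintegral_mono_set (prod_mono_right hsub))
  have h3 : ∫⁻ z in Icc 0 t ×ˢ Icc (-R) R,
      ENNReal.ofReal (Real.exp (t / 2)) * ‖u z.1 z.2 ^ p‖ₑ ≠ ∞ := by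
    rw [lintegral_const_mul' _ _ ENNReal.ofReal_ne_top]
    exact ENNReal.mul_ne_top ENNReal.ofReal_ne_top h1.2.ne
  refine ne_top_of_le_ne_top h3 (lintegral_mono_ae ?_)
  filter_upwards [h2, ae_restrict_mem (measurableSet_Icc.prod measurableSet_Icc)] with z hz hz2
  rw [hz, source]
  split_ifs
  · rw [ENNReal.ofReal_mul (Real.exp_nonneg _)]
    gcongr
    · exact hz2.1.2
    · exact Real.ofReal_le_enorm _
  · exact zero_le

lemma source_lconvolution {p : ℝ} {U : ℝ × ℝ → ℝ} (hU : Measurable U) (t x : ℝ) :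
    (telegraphKernel ⋆ₗ source p U) (t, x) = ∫⁻ τ in Ioo 0 t, ENNReal.ofReal (Real.exp (τ / 2)) *
      dataConv telegraphKernel (fun y => ENNReal.ofReal (U (τ, y) ^ p)) (t - τ, x) := by
  rw [lconvolution_comm, lconvolution_def, Measure.volume_eq_prod,
    lintegral_prod _ (by fun_prop), ← lintegral_indicator measurableSet_Ioo]
  refine lintegral_congr fun τ => ?_
  rw [indicator]
  split_ifs with h
  · rw [dataConv, ← lintegral_const_mul' _ _ ENNReal.ofReal_ne_top]
    refine lintegral_congr fun y => ?_
    rw [source, if_pos h.1, ENNReal.ofReal_mul (Real.exp_nonneg _)]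
    have : (-(τ, y) + (t, x) : ℝ × ℝ) = (t - τ, x - y) :=
      Prod.ext (neg_add_eq_sub _ _) (neg_add_eq_sub _ _)
    rw [this]
    ring
  · rw [lintegral_eq_zero_of_ae_eq_zero]
    refine Eventually.of_forall fun y => ?_
    by_cases h0 : 0 < τ
    · have : telegraphKernel (-(τ, y) + (t, x)) = 0 := by
        rw [telegraphKernel, if_neg]
        intro h1
        have h2 := (abs_nonneg _).trans_lt h1
        have h3 : 0 < -τ + t := h2
        exact h ⟨h0, by linarith⟩
      simp only [this, mul_zero, Pi.zero_apply]
    · simp [source, h0]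

lemma IsMildSolution.integral_S {p : ℝ} {u₀ u₁ : ℝ → ℝ} {u : ℝ → ℝ → ℝ}
    (hu : IsMildSolution p u₀ u₁ u) {U : ℝ × ℝ → ℝ} (hU : Measurable U) (hU0 : ∀ z, 0 ≤ U z)
    (hUu : (fun z : ℝ × ℝ => u z.1 z.2) =ᵐ[(volume.restrict (Ici (0 : ℝ))).prod volume] U)
    {t : ℝ} (ht : 0 ≤ t) (x : ℝ) :
    ∫ τ in (0 : ℝ)..t, S (t - τ) (fun y => u τ y ^ p) x =
      Real.exp (-t / 2) * ((telegraphKernel ⋆ₗ source p U) (t, x)).toReal := by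
  have hfin := hu.lconvolution_source_ne_top hUu t x
  rw [source_lconvolution hU] at hfin ⊢
  have hmeas : Measurable fun τ => ENNReal.ofReal (Real.exp (τ / 2)) *
      dataConv telegraphKernel (fun y => ENNReal.ofReal (U (τ, y) ^ p)) (t - τ, x) := by
    unfold dataConv
    fun_prop
  rw [← integral_toReal hmeas.aemeasurable (ae_lt_top hmeas hfin),
    intervalIntegral.integral_of_le ht, integral_Ioc_eq_integral_Ioo, ← integral_const_mul]
  refine integral_congr_ae ?_
  have h1 := Measure.ae_ae_of_ae_prod hUu
  rw [ae_restrict_iff' measurableSet_Ici] at h1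
  filter_upwards [ae_restrict_mem measurableSet_Ioo, ae_restrict_of_ae h1] with τ hτ h2
  have h3 := h2 hτ.1.le
  have h4 : (fun y => u τ y ^ p) =ᵐ[volume] fun y => U (τ, y) ^ p := by
    filter_upwards [h3] with y hy
    rw [← hy]
  have h5 : Measurable fun y => U (τ, y) ^ p := by fun_prop
  rw [S_congr_ae h4, S_eq_dataConv h5.aestronglyMeasurable
    (Eventually.of_forall fun y => Real.rpow_nonneg (hU0 _) _) (sub_nonneg.2 hτ.2.le),
    ENNReal.toReal_mul, ENNReal.toReal_ofReal (Real.exp_nonneg _), ← mul_assoc, ← Real.exp_add]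
  congr 2
  ring

/-- The mild formulation for `e^{t/2} u`, written without subtraction in `ℝ≥0∞`. -/
lemma IsMildSolution.duhamel {p : ℝ} {u₀ u₁ : ℝ → ℝ} {u : ℝ → ℝ → ℝ}
    (hu : IsMildSolution p u₀ u₁ u) {U : ℝ × ℝ → ℝ} (hU : Measurable U) (hU0 : ∀ z, 0 ≤ U z)
    (hUu : (fun z : ℝ × ℝ => u z.1 z.2) =ᵐ[(volume.restrict (Ici (0 : ℝ))).prod volume] U)
    {f g : ℝ → ℝ} (hf : Measurable f) (hg : Measurable g) (hf0 : ∀ y, 0 ≤ f y)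
    (hg0 : ∀ y, 0 ≤ g y) {M : ℝ} (hfM : ∀ y, f y ≤ M) (hgM : ∀ y, g y ≤ M)
    (hfu : u₀ =ᵐ[volume] f) (hgu : (fun y => u₁ y + u₀ y / 2) =ᵐ[volume] g)
    {t : ℝ} (ht : 0 < t) : ∀ᵐ x : ℝ, ENNReal.ofReal (Real.exp (t / 2) * u t x) +
      (telegraphKernel ⋆ₗ source p U) (t, x) =
        telegraphData (fun y => ENNReal.ofReal (f y)) (t, x) +
          dataConv telegraphKernel (fun y => ENNReal.ofReal (g y)) (t, x) := by
  have hloc : ∀ f : ℝ → ℝ, Measurable f → (∀ y, 0 ≤ f y) → (∀ y, f y ≤ M) →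
      LocallyIntegrable f := by
    intro f hf hf0 hfM
    refine (locallyIntegrable_const M).mono hf.aestronglyMeasurable
      (Eventually.of_forall fun y => ?_)
    rw [Real.norm_of_nonneg (hf0 y)]
    exact (hfM y).trans (le_abs_self M)
  have hfl := hloc f hf hf0 hfM
  have hgl := hloc g hg hg0 hgM
  have hsum : (fun y => u₀ y + u₁ y) =ᵐ[volume] fun y => g y + f y / 2 := by
    filter_upwards [hfu, hgu] with y h1 h2
    rw [← h1, ← h2]
    ring
  filter_upwards [hu.integral_eq t ht.le, hu.nonneg t ht.le, ae_hasDerivAt_S hf hf0 hfM ht]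
    with x hx hx0 hxd
  have hfin := hu.lconvolution_source_ne_top hUu t x
  have hL : telegraphData (fun y => ENNReal.ofReal (f y)) (t, x) ≠ ∞ :=
    telegraphData_ne_top (N := ENNReal.ofReal M) ENNReal.ofReal_ne_top
      (fun y => ENNReal.ofReal_le_ofReal (hfM y)) t x
  have hG : dataConv telegraphKernel (fun y => ENNReal.ofReal (g y)) (t, x) ≠ ∞ := by
    refine ne_top_of_le_ne_top ?_ (dataConv_telegraphKernel_le _ t x)
    refine ENNReal.mul_ne_top ENNReal.ofReal_ne_top
      (ne_top_of_le_ne_top ?_ (lintegral_mono fun z => ENNReal.ofReal_le_ofReal (hgM z)))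
    rw [lintegral_const, Measure.restrict_apply_univ]
    exact ENNReal.mul_ne_top ENNReal.ofReal_ne_top isCompact_Icc.measure_lt_top.ne
  rw [hu.integral_S hU hU0 hUu ht.le, S_congr_ae hsum, dtS_congr_ae hfu, dtS, hxd.deriv,
    S_add hgl (hloc (fun y => f y / 2) (by fun_prop) (fun y => by linarith [hf0 y])
      fun y => by linarith [hf0 y, hfM y]), S_div_two,
    S_eq_dataConv hg.aestronglyMeasurable (Eventually.of_forall hg0) ht.le] at hx
  rw [← ENNReal.toReal_eq_toReal_iff' (ENNReal.add_ne_top.2 ⟨ENNReal.ofReal_ne_top, hfin⟩)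
    (ENNReal.add_ne_top.2 ⟨hL, hG⟩), ENNReal.toReal_add ENNReal.ofReal_ne_top hfin,
    ENNReal.toReal_add hL hG, ENNReal.toReal_ofReal (by positivity), hx]
  have he : Real.exp (t / 2) * Real.exp (-t / 2) = 1 := by
    rw [← Real.exp_add]
    simp [neg_div]
  linear_combination ((telegraphData (fun y => ENNReal.ofReal (f y)) (t, x)).toReal +
    (dataConv telegraphKernel (fun y => ENNReal.ofReal (g y)) (t, x)).toReal -
    ((telegraphKernel ⋆ₗ source p U) (t, x)).toReal) * he

/-! ### The wave formulation and the comparison principle -/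

lemma source_one (U : ℝ × ℝ → ℝ) {z : ℝ × ℝ} (hz : 0 < z.1) :
    source 1 U z = ENNReal.ofReal (Real.exp (z.1 / 2) * U z) := by
  rw [source, if_pos hz, Real.rpow_one]

lemma lconvolution_eq_zero_of_neg {F : ℝ × ℝ → ℝ≥0∞} (hF0 : ∀ z : ℝ × ℝ, z.1 ≤ 0 → F z = 0)
    {t : ℝ} (ht : t < 0) (x : ℝ) : (telegraphKernel ⋆ₗ F) (t, x) = 0 := by
  have := telegraphKernel_lconvolution_le hF0 t x
  rwa [Icc_eq_empty ht.not_ge, empty_prod, setLIntegral_empty, mul_zero,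
    nonpos_iff_eq_zero] at this

/-- A property that holds at almost every positive time for almost every `x`, and trivially at
negative times, holds almost everywhere in space-time. Slices alone would not do: `hP` is needed for
Fubini. -/
lemma ae_of_ae_time {P : ℝ × ℝ → Prop} (hP : MeasurableSet {z | P z})
    (hneg : ∀ t x, t < 0 → P (t, x)) (hpos : ∀ᵐ t : ℝ, 0 < t → ∀ᵐ x : ℝ, P (t, x)) :
    ∀ᵐ z : ℝ × ℝ, P z := by
  rw [Measure.volume_eq_prod, Measure.ae_prod_iff_ae_ae hP]
  filter_upwards [hpos, compl_mem_ae_iff.2 (measure_singleton (0 : ℝ))] with t h1 h2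
  rcases lt_or_gt_of_ne (show t ≠ 0 from h2) with h | h
  · exact Eventually.of_forall fun x => hneg t x h
  · exact h1 h

lemma lconvolution_congr_ae_right {k F G : ℝ × ℝ → ℝ≥0∞} (h : F =ᵐ[volume] G) :
    k ⋆ₗ F = k ⋆ₗ G := by
  rw [lconvolution_comm, lconvolution_comm (f := k)]
  ext z
  simp only [lconvolution_def]
  refine lintegral_congr_ae ?_
  filter_upwards [h] with y hy
  rw [hy]

lemma lconvolution_mono_right {k F G : ℝ × ℝ → ℝ≥0∞} (h : ∀ z, F z ≤ G z) (z : ℝ × ℝ) :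
    (k ⋆ₗ F) z ≤ (k ⋆ₗ G) z :=
  lintegral_mono fun _ => mul_le_mul_right (h _) _

lemma waveKernel_lconvolution_le {F : ℝ × ℝ → ℝ≥0∞} (hF : Measurable F) (z : ℝ × ℝ) :
    (waveKernel ⋆ₗ F) z ≤ (telegraphKernel ⋆ₗ F) z := by
  rw [telegraphKernel_lconvolution hF]
  exact le_self_add

lemma ae_eq_slice {u : ℝ → ℝ → ℝ} {U : ℝ × ℝ → ℝ}
    (hUu : (fun z : ℝ × ℝ => u z.1 z.2) =ᵐ[(volume.restrict (Ici (0 : ℝ))).prod volume] U) :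
    ∀ᵐ t : ℝ, 0 < t → ∀ᵐ x : ℝ, u t x = U (t, x) := by
  have h1 := Measure.ae_ae_of_ae_prod hUu
  rw [ae_restrict_iff' measurableSet_Ici] at h1
  filter_upwards [h1] with t h2 ht
  exact h2 ht.le

/-- The formulation `hE` almost everywhere in space-time, with both sides zero at negative times. -/
lemma ae_duhamel {p : ℝ} {u : ℝ → ℝ → ℝ} {U : ℝ × ℝ → ℝ} (hU : Measurable U)
    (hUu : (fun z : ℝ × ℝ => u z.1 z.2) =ᵐ[(volume.restrict (Ici (0 : ℝ))).prod volume] U)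
    {F G : ℝ → ℝ≥0∞} (hF : Measurable F) (hG : Measurable G)
    (hE : ∀ t : ℝ, 0 < t → ∀ᵐ x : ℝ, ENNReal.ofReal (Real.exp (t / 2) * u t x) +
      (telegraphKernel ⋆ₗ source p U) (t, x) =
        telegraphData F (t, x) + dataConv telegraphKernel G (t, x)) :
    source 1 U + telegraphKernel ⋆ₗ source p U =ᵐ[volume]
      telegraphData F + dataConv telegraphKernel G := by
  have hk := measurable_telegraphKernel
  have hkU := measurable_lconvolution volume hk (measurable_source (p := p) hU)
  refine ae_of_ae_time (measurableSet_eq_fun ((measurable_source hU).add hkU)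
    ((measurable_telegraphData hF).add (measurable_dataConv hk hG))) ?_ ?_
  · intro t x ht
    have h1 : dataConv telegraphKernel G (t, x) = 0 := by
      have := dataConv_telegraphKernel_le G t x
      rwa [Icc_eq_empty (by linarith), setLIntegral_empty, mul_zero, nonpos_iff_eq_zero] at this
    simp only [Pi.add_apply, telegraphData, Pi.smul_apply]
    rw [source_eq_zero 1 U (t, x) ht.le, lconvolution_eq_zero_of_neg (source_eq_zero p U) ht,
      lconvolution_eq_zero_of_neg (waveData_eq_zero F) ht, waveData_eq_zero F (t, x) ht.le, h1]
    simp
  · filter_upwards [ae_eq_slice hUu] with t h2 ht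
    filter_upwards [h2 ht, hE t ht] with x h3 h4
    rw [Pi.add_apply, Pi.add_apply, ← h4, source_one U (z := (t, x)) ht, h3]

/-- The mild formulation with d'Alembert's kernel. It holds at every `t > 0`, not only at almost
every one: `w ⋆ ·` of the identity in space-time is subtracted from the identity at time `t`. -/
lemma wave_duhamel {p : ℝ} {u : ℝ → ℝ → ℝ} {U : ℝ × ℝ → ℝ} (hU : Measurable U)
    (hUu : (fun z : ℝ × ℝ => u z.1 z.2) =ᵐ[(volume.restrict (Ici (0 : ℝ))).prod volume] U)
    (hfin : ∀ t x, (telegraphKernel ⋆ₗ source p U) (t, x) ≠ ∞)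
    {F G : ℝ → ℝ≥0∞} (hF : Measurable F) (hG : Measurable G)
    (hE : ∀ t : ℝ, 0 < t → ∀ᵐ x : ℝ, ENNReal.ofReal (Real.exp (t / 2) * u t x) +
      (telegraphKernel ⋆ₗ source p U) (t, x) =
        telegraphData F (t, x) + dataConv telegraphKernel G (t, x))
    {t : ℝ} (ht : 0 < t) : ∀ᵐ x : ℝ, ENNReal.ofReal (Real.exp (t / 2) * u t x) +
      (waveKernel ⋆ₗ source p U) (t, x) = waveData F (t, x) + dataConv waveKernel G (t, x) +
        1 / 4 * (waveKernel ⋆ₗ source 1 U) (t, x) := by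
  have hw := measurable_waveKernel
  have hk := measurable_telegraphKernel
  have hs := measurable_source (p := p) hU
  have hkU := measurable_lconvolution volume hk hs
  have h1 := lconvolution_congr_ae_right (k := waveKernel) (ae_duhamel hU hUu hF hG hE)
  rw [lconvolution_add_right _ hw (measurable_source hU),
    lconvolution_add_right _ hw (measurable_telegraphData hF)] at h1
  filter_upwards [hE t ht] with x hx
  have h2 := congrFun h1 (t, x)
  have h3 := congrFun (telegraphKernel_lconvolution hs) (t, x)
  have h4 := congrFun (telegraphData_eq hF) (t, x)
  have h5 := congrFun (dataConv_telegraphKernel hG) (t, x)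
  simp only [Pi.add_apply, Pi.smul_apply, smul_eq_mul] at h2 h3 h4 h5
  -- the term that is cancelled from both sides is finite
  have h6 : 1 / 4 * (waveKernel ⋆ₗ (telegraphKernel ⋆ₗ source p U)) (t, x) ≠ ∞ := by
    refine ne_top_of_le_ne_top (hfin t x) ?_
    rw [h3]
    exact le_add_self
  rw [h3, h4, h5] at hx
  refine (ENNReal.add_left_inj h6).1 ?_
  rw [add_assoc, hx, add_assoc _ _ (1 / 4 * (waveKernel ⋆ₗ (telegraphKernel ⋆ₗ source p U)) (t, x)),
    ← mul_add (1 / 4), h2]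
  ring

lemma lintegral_exp_Iio (A : ℝ) :
    ∫⁻ a in Iio A, ENNReal.ofReal (Real.exp (a / 2)) = ENNReal.ofReal (2 * Real.exp (A / 2)) := by
  have h : ∀ a : ℝ, Real.exp (a / 2) = Real.exp (1 / 2 * a) := fun a => by
    rw [one_div_mul_eq_div]
  simp_rw [h]
  rw [setLIntegral_congr Iio_ae_eq_Iic, ← ofReal_integral_eq_lintegral_ofReal
    (integrableOn_exp_mul_Iic (by norm_num) A) (Eventually.of_forall fun _ => Real.exp_nonneg _),
    integral_exp_mul_Iic (by norm_num)]
  congr 1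
  ring

/-- `e^t` is a fixed point of convolution with d'Alembert's kernel. -/
lemma waveKernel_lconvolution_exp (z : ℝ × ℝ) :
    (waveKernel ⋆ₗ fun y => ENNReal.ofReal (Real.exp y.1)) z = ENNReal.ofReal (Real.exp z.1) := by
  obtain ⟨t, x⟩ := z
  rw [waveKernel_lconvolution (by fun_prop)]
  have h : ∀ a b : ℝ, ENNReal.ofReal (Real.exp ((a + b) / 2)) =
      ENNReal.ofReal (Real.exp (a / 2)) * ENNReal.ofReal (Real.exp (b / 2)) := fun a b => by
    rw [← ENNReal.ofReal_mul (Real.exp_nonneg _), ← Real.exp_add, add_div]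
  simp_rw [h, lintegral_const_mul' _ _ ENNReal.ofReal_ne_top, lintegral_exp_Iio]
  rw [lintegral_mul_const' _ _ ENNReal.ofReal_ne_top, lintegral_exp_Iio,
    show (1 / 4 : ℝ≥0∞) = ENNReal.ofReal (1 / 4) by
      rw [ENNReal.ofReal_div_of_pos (by norm_num)]; norm_num,
    ← ENNReal.ofReal_mul (by positivity), ← ENNReal.ofReal_mul (by norm_num)]
  congr 1
  have : Real.exp t = Real.exp ((t + x) / 2) * Real.exp ((t - x) / 2) := by
    rw [← Real.exp_add]
    congr 1
    ring
  rw [this]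
  ring

/-- A Gronwall lemma: iterating the inequality from a local bound gives `m ≤ 4⁻ⁿ K e^t` for all `n`.
-/
lemma ae_eq_zero_of_le_waveKernel_lconvolution {m : ℝ × ℝ → ℝ≥0∞}
    (hm0 : ∀ z : ℝ × ℝ, z.1 ≤ 0 → m z = 0)
    (hle : ∀ᵐ z, m z ≤ 1 / 4 * (waveKernel ⋆ₗ m) z)
    (hbd : ∀ T : ℝ, ∃ K : ℝ≥0∞, K ≠ ∞ ∧ ∀ᵐ z : ℝ × ℝ, z.1 ≤ T → m z ≤ K) : m =ᵐ[volume] 0 := by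
  have key : ∀ T : ℕ, ∀ᵐ z : ℝ × ℝ, z.1 ≤ T → m z = 0 := by
    intro T
    obtain ⟨K, hK, hmK⟩ := hbd T
    have step : ∀ n : ℕ, ∀ᵐ z : ℝ × ℝ, z.1 ≤ T →
        m z ≤ (1 / 4) ^ n * (K * ENNReal.ofReal (Real.exp z.1)) := by
      intro n
      induction n with
      | zero =>
        filter_upwards [hmK] with z hz hzT
        by_cases h0 : z.1 ≤ 0
        · simp [hm0 z h0]
        · refine (hz hzT).trans ?_
          rw [pow_zero, one_mul]
          refine le_mul_of_one_le_right' ?_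
          rw [ENNReal.one_le_ofReal]
          exact Real.one_le_exp (not_le.1 h0).le
      | succ n ih =>
        filter_upwards [hle] with z hz hzT
        refine hz.trans ?_
        rw [pow_succ', mul_assoc]
        gcongr
        have h1 : (waveKernel ⋆ₗ m) z ≤ (waveKernel ⋆ₗ
            (((1 / 4) ^ n * K) • fun y : ℝ × ℝ => ENNReal.ofReal (Real.exp y.1))) z := by
          rw [lconvolution_comm, lconvolution_comm (f := waveKernel), lconvolution_def,
            lconvolution_def]
          refine lintegral_mono_ae ?_
          filter_upwards [ih] with y hy
          by_cases hyT : y.1 ≤ T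
          · gcongr
            refine (hy hyT).trans_eq ?_
            simp [mul_assoc]
          · rw [waveKernel, if_neg, mul_zero]
            · exact zero_le
            · intro h
              have h2 : 0 < -y.1 + z.1 := (abs_nonneg _).trans_lt h
              linarith
        refine h1.trans_eq ?_
        rw [lconvolution_smul_right _ _ (ENNReal.mul_ne_top (ENNReal.pow_ne_top (by norm_num)) hK),
          Pi.smul_apply, waveKernel_lconvolution_exp, smul_eq_mul, mul_assoc]
    filter_upwards [ae_all_iff.2 step] with z hz hzT
    have h2 : Tendsto (fun n : ℕ => (1 / 4 : ℝ≥0∞) ^ n * (K * ENNReal.ofReal (Real.exp z.1)))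
        atTop (𝓝 (0 * (K * ENNReal.ofReal (Real.exp z.1)))) :=
      ENNReal.Tendsto.mul_const (ENNReal.tendsto_pow_atTop_nhds_zero_of_lt_one
        (by rw [one_div]; exact ENNReal.inv_lt_one.2 (by norm_num)))
        (Or.inr (ENNReal.mul_ne_top hK ENNReal.ofReal_ne_top))
    rw [zero_mul] at h2
    exact nonpos_iff_eq_zero.1 (ge_of_tendsto' h2 fun n => hz n hzT)
  filter_upwards [ae_all_iff.2 key] with z hz
  obtain ⟨T, hT⟩ := exists_nat_ge z.1
  exact hz T hT

/-- Comparison principle: a solution `u` with data `F`, `G` stays below a supersolution `V` of the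
wave formulation with the same data. `U` is a measurable representative of `u`. The condition `hδ`
says that `r / 4 - r ^ p` is nondecreasing on `[0, δ]`, and only `V`, not `u`, has to be bounded by
`δ`: where `U > V`, the sign of `V ^ p - U ^ p` suffices. -/
theorem comparison {p : ℝ} {u : ℝ → ℝ → ℝ} {U V : ℝ × ℝ → ℝ} (hU : Measurable U)
    (hV : Measurable V) (hU0 : ∀ z, 0 ≤ U z) (hV0 : ∀ z : ℝ × ℝ, 0 < z.1 → 0 ≤ V z) {δ : ℝ}
    (hVδ : ∀ z : ℝ × ℝ, 0 < z.1 → V z ≤ δ) (hp : 0 ≤ p)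
    (hδ : ∀ r s : ℝ, 0 ≤ r → r ≤ s → s ≤ δ → s ^ p - r ^ p ≤ (s - r) / 4)
    (hUu : (fun z : ℝ × ℝ => u z.1 z.2) =ᵐ[(volume.restrict (Ici (0 : ℝ))).prod volume] U)
    (hfin : ∀ t x, (telegraphKernel ⋆ₗ source p U) (t, x) ≠ ∞)
    {F G : ℝ → ℝ≥0∞} (hF : Measurable F) (hG : Measurable G) {N : ℝ≥0∞} (hN : N ≠ ∞)
    (hFN : ∀ y, F y ≤ N) (hGN : ∀ y, G y ≤ N)
    (hE : ∀ t : ℝ, 0 < t → ∀ᵐ x : ℝ, ENNReal.ofReal (Real.exp (t / 2) * u t x) +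
      (telegraphKernel ⋆ₗ source p U) (t, x) =
        telegraphData F (t, x) + dataConv telegraphKernel G (t, x))
    (hsup : ∀ t x : ℝ, 0 < t → waveData F (t, x) + dataConv waveKernel G (t, x) +
        1 / 4 * (waveKernel ⋆ₗ source 1 V) (t, x) ≤
      ENNReal.ofReal (Real.exp (t / 2) * V (t, x)) + (waveKernel ⋆ₗ source p V) (t, x))
    {t : ℝ} (ht : 0 < t) : ∀ᵐ x : ℝ, u t x ≤ V (t, x) := by
  have hw := measurable_waveKernel
  have hk := measurable_telegraphKernel
  have hs := measurable_source (p := p) hU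
  set m : ℝ × ℝ → ℝ≥0∞ := fun z => source 1 U z - source 1 V z with hm
  have hmm : Measurable m := (measurable_source hU).sub (measurable_source hV)
  have hpt : ∀ z, source p V z + 1 / 4 * source 1 U z ≤
      source p U z + (1 / 4 * source 1 V z + 1 / 4 * m z) := by
    intro z
    by_cases hz : 0 < z.1
    · have h4 : (1 / 4 : ℝ≥0∞) = ENNReal.ofReal (1 / 4) := by
        rw [ENNReal.ofReal_div_of_pos (by norm_num)]; norm_num
      have he := Real.exp_pos (z.1 / 2)
      have hUz := hU0 z
      have hVz := hV0 z hz
      -- monotonicity of `r / 4 - r ^ p` where `U ≤ V`, and of `r ^ p` where `U ≥ V`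
      rcases le_total (U z) (V z) with h | h
      · refine le_trans ?_ (add_le_add_right le_self_add _)
        rw [source_one U hz, source_one V hz, source, source, if_pos hz, if_pos hz, h4,
          ← ENNReal.ofReal_mul (by norm_num), ← ENNReal.ofReal_mul (by norm_num),
          ← ENNReal.ofReal_add (by positivity) (by positivity),
          ← ENNReal.ofReal_add (by positivity) (by positivity)]
        refine ENNReal.ofReal_le_ofReal ?_
        have := hδ _ _ hUz h (hVδ z hz)
        nlinarith
      · rw [← mul_add, hm]
        simp only
        rw [add_tsub_cancel_of_le]
        · gcongr
          rw [source, source, if_pos hz, if_pos hz]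
          gcongr
        · rw [source_one U hz, source_one V hz]
          gcongr
    · have hz := not_lt.1 hz
      simp [hm, source_eq_zero _ _ z hz]
  have hwV : ∀ t x, (waveKernel ⋆ₗ source 1 V) (t, x) ≠ ∞ := by
    intro t x
    refine ne_top_of_le_ne_top ?_ (waveKernel_lconvolution_le (measurable_source hV) _)
    refine lconvolution_ne_top (source_eq_zero 1 V)
      (N := ENNReal.ofReal (Real.exp (t / 2) * δ)) ENNReal.ofReal_ne_top (fun z hz => ?_) x
    by_cases h0 : 0 < z.1
    · rw [source_one V h0]
      have := hV0 z h0
      have := hVδ z h0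
      gcongr
    · rw [source_eq_zero 1 V z (not_lt.1 h0)]
      exact zero_le
  have hmain : ∀ t : ℝ, 0 < t → ∀ᵐ x : ℝ, ENNReal.ofReal (Real.exp (t / 2) * u t x) ≤
      ENNReal.ofReal (Real.exp (t / 2) * V (t, x)) + 1 / 4 * (waveKernel ⋆ₗ m) (t, x) := by
    intro t ht
    filter_upwards [wave_duhamel hU hUu hfin hF hG hE ht] with x hx
    have h1 := lconvolution_mono_right (k := waveKernel) hpt (t, x)
    change (waveKernel ⋆ₗ (source p V + (1 / 4 : ℝ≥0∞) • source 1 U)) (t, x) ≤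
      (waveKernel ⋆ₗ (source p U + ((1 / 4 : ℝ≥0∞) • source 1 V + (1 / 4 : ℝ≥0∞) • m))) (t, x) at h1
    rw [lconvolution_add_right _ hw (measurable_source hV), lconvolution_add_right _ hw hs,
      lconvolution_add_right _ hw ((measurable_source hV).const_smul _),
      lconvolution_smul_right _ _ (by norm_num), lconvolution_smul_right _ _ (by norm_num),
      lconvolution_smul_right _ _ (by norm_num)] at h1
    simp only [Pi.add_apply, Pi.smul_apply, smul_eq_mul] at h1
    have hfw : (waveKernel ⋆ₗ source p U) (t, x) + 1 / 4 * (waveKernel ⋆ₗ source 1 V) (t, x) ≠ ∞ :=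
      ENNReal.add_ne_top.2 ⟨ne_top_of_le_ne_top (hfin t x) (waveKernel_lconvolution_le hs _),
        ENNReal.mul_ne_top (by norm_num) (hwV t x)⟩
    refine (ENNReal.add_le_add_iff_right hfw).1 ?_
    calc ENNReal.ofReal (Real.exp (t / 2) * u t x) + ((waveKernel ⋆ₗ source p U) (t, x) +
          1 / 4 * (waveKernel ⋆ₗ source 1 V) (t, x))
        = waveData F (t, x) + dataConv waveKernel G (t, x) +
          1 / 4 * (waveKernel ⋆ₗ source 1 V) (t, x) +
            1 / 4 * (waveKernel ⋆ₗ source 1 U) (t, x) := by rw [← add_assoc, hx]; ring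
      _ ≤ ENNReal.ofReal (Real.exp (t / 2) * V (t, x)) + (waveKernel ⋆ₗ source p V) (t, x) +
            1 / 4 * (waveKernel ⋆ₗ source 1 U) (t, x) := by
          exact add_le_add (hsup t x ht) le_rfl
      _ ≤ ENNReal.ofReal (Real.exp (t / 2) * V (t, x)) + ((waveKernel ⋆ₗ source p U) (t, x) +
            (1 / 4 * (waveKernel ⋆ₗ source 1 V) (t, x) +
              1 / 4 * (waveKernel ⋆ₗ m) (t, x))) := by
          rw [add_assoc]
          gcongr
      _ = _ := by ring
  have hm0 : ∀ z : ℝ × ℝ, z.1 ≤ 0 → m z = 0 := fun z hz => by simp [hm, source_eq_zero 1 U z hz]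
  have hmz : m =ᵐ[volume] 0 := by
    refine ae_eq_zero_of_le_waveKernel_lconvolution hm0 ?_ ?_
    · refine ae_of_ae_time (measurableSet_le hmm
        ((measurable_lconvolution volume hw hmm).const_mul _)) ?_ ?_
      · intro t x ht
        rw [hm0 _ ht.le]
        exact zero_le
      · filter_upwards [ae_eq_slice hUu] with t h2 ht
        filter_upwards [h2 ht, hmain t ht] with x h3 h4
        rw [hm]
        simp only
        rw [tsub_le_iff_left, source_one U (z := (t, x)) ht, source_one V (z := (t, x)) ht, ← h3]
        exact h4
    · intro T
      set J := ENNReal.ofReal (riemannFun (T ^ 2) / 2)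
      refine ⟨N + 1 / 4 * (J * (N * (ENNReal.ofReal T * ENNReal.ofReal (2 * T)))) +
        J * (N * ENNReal.ofReal (2 * T)), by finiteness, ?_⟩
      filter_upwards [ae_duhamel hU hUu hF hG hE] with z hz hzT
      by_cases h0 : z.1 ≤ 0
      · rw [hm0 z h0]
        exact zero_le
      have h0 := not_le.1 h0
      obtain ⟨t, x⟩ := z
      have ht : t ≤ T := hzT
      have ht0 : 0 < t := h0
      have hJ : ENNReal.ofReal (riemannFun (t ^ 2) / 2) ≤ J := by
        refine ENNReal.ofReal_le_ofReal ?_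
        gcongr
        exact riemannFun_mono (by positivity) (by gcongr)
      have hlen : x + t - (x - t) ≤ 2 * T := by linarith
      calc m (t, x) ≤ source 1 U (t, x) := tsub_le_self
        _ ≤ (source 1 U + telegraphKernel ⋆ₗ source p U) (t, x) := le_self_add
        _ = telegraphData F (t, x) + dataConv telegraphKernel G (t, x) := hz
        _ ≤ _ := by
          refine add_le_add (add_le_add (waveData_le hFN _) (mul_le_mul_right
            ((telegraphKernel_lconvolution_le (waveData_eq_zero F) t x).trans ?_) _))
            ((dataConv_telegraphKernel_le G t x).trans ?_)
          · refine mul_le_mul' hJ ((lintegral_mono fun z => waveData_le hFN z).trans ?_)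
            rw [lintegral_const, Measure.restrict_apply_univ, Measure.volume_eq_prod,
              Measure.prod_prod, Real.volume_Icc, Real.volume_Icc, sub_zero]
            gcongr
          · refine mul_le_mul' hJ ((lintegral_mono fun z => hGN z).trans ?_)
            rw [lintegral_const, Measure.restrict_apply_univ, Real.volume_Icc]
            gcongr
  have hwm : waveKernel ⋆ₗ m = 0 := by
    rw [lconvolution_congr_ae_right hmz, lconvolution_zero]
  filter_upwards [hmain t ht] with x hx
  rw [hwm, Pi.zero_apply, mul_zero, add_zero, ENNReal.ofReal_le_ofReal_iff
    (mul_nonneg (Real.exp_nonneg _) (hV0 _ ht))] at hx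
  exact le_of_mul_le_mul_left hx (Real.exp_pos _)

/-! ### The supersolution -/

lemma lintegral_Ioo_ofReal {f : ℝ → ℝ} (hf : Continuous f) {a b : ℝ} (hab : a ≤ b)
    (hf0 : ∀ x ∈ Ioo a b, 0 ≤ f x) :
    ∫⁻ x in Ioo a b, ENNReal.ofReal (f x) = ENNReal.ofReal (∫ x in a..b, f x) := by
  rw [intervalIntegral.integral_of_le hab, integral_Ioc_eq_integral_Ioo,
    ofReal_integral_eq_lintegral_ofReal]
  · exact (hf.integrableOn_Icc (a := a) (b := b)).mono_set Ioo_subset_Icc_self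
  · filter_upwards [ae_restrict_mem measurableSet_Ioo] with x hx using hf0 x hx

lemma waveKernel_lconvolution_ofReal {f : ℝ × ℝ → ℝ} (hf : Continuous f) (hf0 : ∀ z, 0 ≤ f z)
    {t : ℝ} (ht : 0 ≤ t) (x : ℝ) :
    (waveKernel ⋆ₗ fun z => if 0 < z.1 then ENNReal.ofReal (f z) else 0) (t, x) =
      ENNReal.ofReal (1 / 4 * ∫ ξ in (-(t - x))..(t + x), ∫ η in (-ξ)..(t - x),
        f ((ξ + η) / 2, (ξ - η) / 2)) := by
  rw [waveKernel_lconvolution (Measurable.ite (measurableSet_lt measurable_const measurable_fst)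
    (by have := hf.measurable; fun_prop) measurable_const)]
  have hi : Continuous fun ξ : ℝ => ∫ η in (-ξ)..(t - x), f ((ξ + η) / 2, (ξ - η) / 2) := by
    have h1 := intervalIntegral.continuous_parametric_intervalIntegral_of_continuous
      (μ := volume) (f := fun ξ η : ℝ => f ((ξ + η) / 2, (ξ - η) / 2)) (a₀ := t - x)
      (s := fun ξ => -ξ) (by fun_prop) (by fun_prop)
    convert h1.neg using 2
    exact intervalIntegral.integral_symm _ _
  have hi0 : ∀ ξ ∈ Ioo (-(t - x)) (t + x),
      0 ≤ ∫ η in (-ξ)..(t - x), f ((ξ + η) / 2, (ξ - η) / 2) := fun ξ hξ =>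
    intervalIntegral.integral_nonneg (by linarith [hξ.1]) fun η _ => hf0 _
  rw [ENNReal.ofReal_mul (by norm_num), ← lintegral_Ioo_ofReal hi (by linarith) hi0]
  congr 1
  · rw [ENNReal.ofReal_div_of_pos (by norm_num)]; norm_num
  rw [← lintegral_indicator measurableSet_Iio, ← lintegral_indicator measurableSet_Ioo]
  refine lintegral_congr fun ξ => ?_
  have hin : ∫⁻ η in Iio (t - x),
      (if 0 < (ξ + η) / 2 then ENNReal.ofReal (f ((ξ + η) / 2, (ξ - η) / 2)) else 0) =
      ∫⁻ η in Ioo (-ξ) (t - x), ENNReal.ofReal (f ((ξ + η) / 2, (ξ - η) / 2)) := by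
    rw [← Ioi_inter_Iio, ← setLIntegral_indicator measurableSet_Ioi]
    refine lintegral_congr fun η => ?_
    have : 0 < (ξ + η) / 2 ↔ -ξ < η := by constructor <;> intro h <;> linarith
    simp only [this, indicator, mem_Ioi]
  by_cases h : ξ ∈ Ioo (-(t - x)) (t + x)
  · rw [indicator_of_mem h, indicator_of_mem (mem_Iio.2 h.2)]
    refine hin.trans ?_
    rw [lintegral_Ioo_ofReal (by fun_prop) (by linarith [h.1]) fun η _ => hf0 _]
  · rw [indicator_of_notMem h, indicator]
    split_ifs with h'
    · have : t - x ≤ -ξ := by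
        by_contra h2
        exact h ⟨by linarith, h'⟩
      refine hin.trans ?_
      rw [Ioo_eq_empty this.not_gt, setLIntegral_empty]
    · rfl

lemma dataConv_waveKernel_ofReal {f : ℝ → ℝ} (hf : Continuous f) (hf0 : ∀ y, 0 ≤ f y)
    {t : ℝ} (ht : 0 ≤ t) (x : ℝ) :
    dataConv waveKernel (fun y => ENNReal.ofReal (f y)) (t, x) =
      ENNReal.ofReal ((1 / 2) * ∫ y in (x - t)..(x + t), f y) := by
  rw [← toReal_dataConv_waveKernel hf.locallyIntegrable hf0 ht, ENNReal.ofReal_toReal]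
  have h : dataConv waveKernel (fun y => ENNReal.ofReal (f y)) (t, x) ≤
      dataConv telegraphKernel (fun y => ENNReal.ofReal (f y)) (t, x) := by
    rw [dataConv_telegraphKernel (by have := hf.measurable; fun_prop)]
    exact le_self_add
  refine ne_top_of_le_ne_top ?_ (h.trans (dataConv_telegraphKernel_le _ t x))
  refine ENNReal.mul_ne_top ENNReal.ofReal_ne_top ?_
  rw [← ofReal_integral_eq_lintegral_ofReal hf.integrableOn_Icc (Eventually.of_forall hf0)]
  exact ENNReal.ofReal_ne_top

/-- The barrier `(a(x) + c t)^{-γ}`. The time is replaced by its positive part, which makes the base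
positive and the function continuous on the whole plane when `a > 0` is continuous. -/
noncomputable def barrier (a : ℝ → ℝ) (γ c : ℝ) (z : ℝ × ℝ) : ℝ := (a z.2 + c * max z.1 0) ^ (-γ)

/-- The barrier is a supersolution in the wave formulation, with data its initial value and half of
`a^{-γ} - a^{-γ-1}`, which is the initial velocity of `e^{t/2}` times the barrier. The hypotheses
`hA` and `hB` say that `a''` and `a'² / a` are small. -/
theorem barrier_supersolution {a a' a'' : ℝ → ℝ} (ha : ∀ x, HasDerivAt a (a' x) x)
    (ha' : ∀ x, HasDerivAt a' (a'' x) x) (ha'' : Continuous a'') (h1 : ∀ x, 1 ≤ a x) {γ c p : ℝ}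
    (hγ : 0 < γ) (hc : γ * c = 1 / 2) (hA : ∀ x, -(1 / 4) ≤ γ * a'' x)
    (hB : ∀ x, γ * (γ + 1) * a' x ^ 2 ≤ a x / 4) (hp : γ * p = γ + 1) {t : ℝ} (ht : 0 < t) (x : ℝ) :
    waveData (fun y => ENNReal.ofReal (a y ^ (-γ))) (t, x) +
      dataConv waveKernel (fun y => ENNReal.ofReal ((a y ^ (-γ) - a y ^ (-γ - 1)) / 2)) (t, x) +
        1 / 4 * (waveKernel ⋆ₗ source 1 (barrier a γ c)) (t, x) ≤
      ENNReal.ofReal (Real.exp (t / 2) * barrier a γ c (t, x)) +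
        (waveKernel ⋆ₗ source p (barrier a γ c)) (t, x) := by
  have hc0 : 0 < c := by
    by_contra h
    nlinarith
  have hac : Continuous a := continuous_iff_continuousAt.2 fun x => (ha x).continuousAt
  have hac' : Continuous a' := continuous_iff_continuousAt.2 fun x => (ha' x).continuousAt
  have hapos : ∀ x, 0 < a x := fun x => zero_lt_one.trans_le (h1 x)
  have hΦ : ∀ z : ℝ × ℝ, a z.2 ≤ a z.2 + c * max z.1 0 := fun z => by
    have := le_max_right z.1 0
    have : 0 ≤ c * max z.1 0 := by positivity
    linarith
  have hΦ0 : ∀ z : ℝ × ℝ, 0 < a z.2 + c * max z.1 0 := fun z => (hapos _).trans_le (hΦ z)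
  have hbc : ∀ q : ℝ, Continuous fun z : ℝ × ℝ => (a z.2 + c * max z.1 0) ^ q := fun q =>
    Continuous.rpow_const (by fun_prop) fun z => Or.inl (hΦ0 z).ne'
  -- light-cone coordinates `ξ = t + x`, `η = t - x`; `P` is the derivative in `ξ` of
  -- `V = e^{t/2} (barrier)`, and `H` is the derivative of `P` in `η`, a quarter of the d'Alembertian of `V`
  set ψ : ℝ → ℝ → ℝ := fun ξ η => a ((ξ - η) / 2) + c * max ((ξ + η) / 2) 0 with hψ
  have hψ0 : ∀ ξ η, 0 < ψ ξ η := fun ξ η => hΦ0 ((ξ + η) / 2, (ξ - η) / 2)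
  have hψa : ∀ ξ η, a ((ξ - η) / 2) ≤ ψ ξ η := fun ξ η => hΦ ((ξ + η) / 2, (ξ - η) / 2)
  have hmax : ∀ s : ℝ, 0 < s → HasDerivAt (fun s : ℝ => max (s / 2) 0) (1 / 2) s := fun s hs => by
    refine ((hasDerivAt_id s).div_const 2).congr_of_eventuallyEq ?_
    filter_upwards [Ioi_mem_nhds hs] with r hr
    exact max_eq_left (by have : 0 < r := hr; simp; linarith)
  have hψξ : ∀ ξ η, 0 < ξ + η →
      HasDerivAt (fun ξ => ψ ξ η) ((a' ((ξ - η) / 2) + c) / 2) ξ := fun ξ η h => by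
    have e1 := (ha ((ξ - η) / 2)).comp ξ (((hasDerivAt_id ξ).sub_const η).div_const 2)
    have e2 := ((hmax (ξ + η) h).comp ξ ((hasDerivAt_id ξ).add_const η)).const_mul c
    refine (e1.add e2).congr_deriv (by ring)
  have hψη : ∀ ξ η, 0 < ξ + η →
      HasDerivAt (fun η => ψ ξ η) ((c - a' ((ξ - η) / 2)) / 2) η := fun ξ η h => by
    have e1 := (ha ((ξ - η) / 2)).comp η (((hasDerivAt_id η).const_sub ξ).div_const 2)
    have e2 := ((hmax (ξ + η) h).comp η ((hasDerivAt_id η).const_add ξ)).const_mul c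
    refine (e1.add e2).congr_deriv (by ring)
  set E : ℝ → ℝ → ℝ := fun ξ η => Real.exp ((ξ + η) / 4) with hE
  have hEξ : ∀ ξ η, HasDerivAt (fun ξ => E ξ η) (E ξ η * (1 / 4)) ξ := fun ξ η =>
    (((hasDerivAt_id ξ).add_const η).div_const 4).exp
  have hEη : ∀ ξ η, HasDerivAt (fun η => E ξ η) (E ξ η * (1 / 4)) η := fun ξ η =>
    (((hasDerivAt_id η).const_add ξ).div_const 4).exp
  set V : ℝ → ℝ → ℝ := fun ξ η => E ξ η * ψ ξ η ^ (-γ) with hV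
  set P : ℝ → ℝ → ℝ := fun ξ η => E ξ η *
    (1 / 4 * ψ ξ η ^ (-γ) - γ / 2 * ((a' ((ξ - η) / 2) + c) * ψ ξ η ^ (-γ - 1))) with hP
  set H : ℝ → ℝ → ℝ := fun ξ η => E ξ η * (1 / 16 * ψ ξ η ^ (-γ) +
    (-(1 / 8) + γ * a'' ((ξ - η) / 2) / 4) * ψ ξ η ^ (-γ - 1) +
    γ * (γ + 1) / 4 * (c ^ 2 - a' ((ξ - η) / 2) ^ 2) * ψ ξ η ^ (-γ - 1 - 1)) with hH
  have hVP : ∀ ξ η, 0 < ξ + η → HasDerivAt (fun ξ => V ξ η) (P ξ η) ξ := fun ξ η h => by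
    refine ((hEξ ξ η).mul ((hψξ ξ η h).rpow_const (p := -γ) (Or.inl (hψ0 ξ η).ne'))).congr_deriv ?_
    rw [hP]
    ring
  have hPH : ∀ ξ η, 0 < ξ + η → HasDerivAt (fun η => P ξ η) (H ξ η) η := fun ξ η h => by
    have e1 := (hψη ξ η h).rpow_const (p := -γ) (Or.inl (hψ0 ξ η).ne')
    have e2 := (hψη ξ η h).rpow_const (p := -γ - 1) (Or.inl (hψ0 ξ η).ne')
    have e3 : HasDerivAt (fun η => (a' ((ξ - η) / 2) + c) * ψ ξ η ^ (-γ - 1)) _ η :=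
      (((ha' ((ξ - η) / 2)).comp η (((hasDerivAt_id η).const_sub ξ).div_const 2)).add_const
        c).mul e2
    have e4 : HasDerivAt (fun η => 1 / 4 * ψ ξ η ^ (-γ) -
        γ / 2 * ((a' ((ξ - η) / 2) + c) * ψ ξ η ^ (-γ - 1))) _ η :=
      (e1.const_mul (1 / 4)).sub (e3.const_mul (γ / 2))
    have e5 : HasDerivAt (fun η => P ξ η) _ η := (hEη ξ η).mul e4
    refine e5.congr_deriv ?_
    rw [hH]
    simp only [Function.comp, id]
    linear_combination (-(1 / 4) * E ξ η * ψ ξ η ^ (-γ - 1)) * hc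
  have hψc : ∀ q : ℝ, Continuous fun z : ℝ × ℝ => ψ z.1 z.2 ^ q := fun q =>
    (hbc q).comp (by fun_prop : Continuous fun z : ℝ × ℝ => ((z.1 + z.2) / 2, (z.1 - z.2) / 2))
  have hEc : Continuous fun z : ℝ × ℝ => E z.1 z.2 := by fun_prop
  have hVc : Continuous fun z : ℝ × ℝ => V z.1 z.2 := hEc.mul (hψc _)
  have hZc : Continuous fun z : ℝ × ℝ => E z.1 z.2 * ψ z.1 z.2 ^ (-γ - 1) := hEc.mul (hψc _)
  have hPc : Continuous fun z : ℝ × ℝ => P z.1 z.2 := by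
    have := hψc (-γ); have := hψc (-γ - 1)
    refine hEc.mul ?_
    fun_prop
  have hPd : Continuous fun ξ => P ξ (-ξ) :=
    hPc.comp (by fun_prop : Continuous fun ξ : ℝ => (ξ, -ξ))
  have hHc : Continuous fun z : ℝ × ℝ => H z.1 z.2 := by
    have := hψc (-γ); have := hψc (-γ - 1); have := hψc (-γ - 1 - 1)
    refine hEc.mul ?_
    fun_prop
  -- the differential inequality `∂ₜ²V - ∂ₓ²V ≥ V / 4 - e^{t/2} (barrier)^p`, divided by four
  have hineq : ∀ ξ η, 1 / 16 * V ξ η ≤ H ξ η + 1 / 4 * (E ξ η * ψ ξ η ^ (-γ - 1)) := fun ξ η => by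
    have hE0 : 0 < E ξ η := Real.exp_pos _
    have hr : ψ ξ η ^ (-γ - 1) = ψ ξ η * ψ ξ η ^ (-γ - 1 - 1) := by
      rw [Real.rpow_sub_one (hψ0 ξ η).ne' (-γ - 1), mul_div_cancel₀ _ (hψ0 ξ η).ne']
    have hr0 : 0 < ψ ξ η ^ (-γ - 1 - 1) := Real.rpow_pos_of_pos (hψ0 ξ η) _
    have e1 : 0 ≤ (1 / 8 + γ * a'' ((ξ - η) / 2) / 4) * ψ ξ η +
        γ * (γ + 1) / 4 * (c ^ 2 - a' ((ξ - η) / 2) ^ 2) := by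
      have := hA ((ξ - η) / 2)
      have := hB ((ξ - η) / 2)
      have := hψa ξ η
      have := hψ0 ξ η
      have : 0 ≤ γ * (γ + 1) / 4 * c ^ 2 := by positivity
      nlinarith
    have e2 := mul_nonneg (mul_nonneg hE0.le hr0.le) e1
    simp only [hV, hH]
    rw [hr]
    linarith
  -- d'Alembert's formula; the derivatives exist only for `ξ + η > 0`, in the interior of the cone
  have hdal : ∫ ξ in (-(t - x))..(t + x), ∫ η in (-ξ)..(t - x), H ξ η =
      V (t + x) (t - x) - V (-(t - x)) (t - x) - ∫ ξ in (-(t - x))..(t + x), P ξ (-ξ) := by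
    have e1 : ∀ ξ ∈ Icc (-(t - x)) (t + x),
        ∫ η in (-ξ)..(t - x), H ξ η = P ξ (t - x) - P ξ (-ξ) := fun ξ hξ => by
      refine intervalIntegral.integral_eq_sub_of_hasDerivAt_of_le (by linarith [hξ.1]) ?_ ?_ ?_
      · exact (hPc.comp (by fun_prop : Continuous fun η => (ξ, η))).continuousOn
      · exact fun η hη => hPH ξ η (by linarith [hη.1])
      · exact (hHc.comp (by fun_prop : Continuous fun η => (ξ, η))).intervalIntegrable _ _
    have e2 : ∫ ξ in (-(t - x))..(t + x), P ξ (t - x) =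
        V (t + x) (t - x) - V (-(t - x)) (t - x) := by
      refine intervalIntegral.integral_eq_sub_of_hasDerivAt_of_le (f := fun ξ => V ξ (t - x))
        (by linarith) ?_ ?_ ?_
      · exact (hVc.comp (by fun_prop : Continuous fun ξ => (ξ, t - x))).continuousOn
      · exact fun ξ hξ => hVP ξ (t - x) (by linarith [hξ.1])
      · exact (hPc.comp (by fun_prop : Continuous fun ξ => (ξ, t - x))).intervalIntegrable _ _
    rw [intervalIntegral.integral_congr (g := fun ξ => P ξ (t - x) - P ξ (-ξ)),
      intervalIntegral.integral_sub, e2]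
    · exact (hPc.comp (by fun_prop : Continuous fun ξ => (ξ, t - x))).intervalIntegrable _ _
    · exact hPd.intervalIntegrable _ _
    · intro ξ hξ
      rw [uIcc_of_le (by linarith)] at hξ
      exact e1 ξ hξ
  have hac0 : ∀ q : ℝ, Continuous fun y => a y ^ q := fun q =>
    hac.rpow_const fun y => Or.inl (hapos y).ne'
  have hdiag : ∀ ξ, P ξ (-ξ) = 1 / 2 * ((a ξ ^ (-γ) - a ξ ^ (-γ - 1)) / 2) +
      1 / 2 * (a' ξ * (-γ) * a ξ ^ (-γ - 1)) := fun ξ => by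
    have e1 : (ξ - -ξ) / 2 = ξ := by ring
    simp only [hP, hE, hψ, e1, add_neg_cancel, zero_div, Real.exp_zero, max_self, mul_zero,
      add_zero]
    linear_combination (-(1 / 2) * a ξ ^ (-γ - 1)) * hc
  have hdata : ∫ ξ in (-(t - x))..(t + x), P ξ (-ξ) =
      1 / 2 * (∫ y in (x - t)..(x + t), (a y ^ (-γ) - a y ^ (-γ - 1)) / 2) +
        1 / 2 * (a (x + t) ^ (-γ) - a (x - t) ^ (-γ)) := by
    have := hac0 (-γ); have := hac0 (-γ - 1)
    have e2 : ∫ ξ in (x - t)..(x + t), a' ξ * (-γ) * a ξ ^ (-γ - 1) =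
        a (x + t) ^ (-γ) - a (x - t) ^ (-γ) :=
      intervalIntegral.integral_eq_sub_of_hasDerivAt
        (fun ξ _ => (ha ξ).rpow_const (Or.inl (hapos ξ).ne'))
        ((by fun_prop : Continuous fun ξ => a' ξ * (-γ) * a ξ ^ (-γ - 1)).intervalIntegrable _ _)
    simp_rw [hdiag]
    rw [neg_sub, add_comm t x, intervalIntegral.integral_add
      ((by fun_prop : Continuous fun ξ => _).intervalIntegrable _ _)
      ((by fun_prop : Continuous fun ξ => _).intervalIntegrable _ _),
      intervalIntegral.integral_const_mul, intervalIntegral.integral_const_mul, e2]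
  -- the differential inequality integrated over the backward cone
  have hint : 1 / 16 * (∫ ξ in (-(t - x))..(t + x), ∫ η in (-ξ)..(t - x), V ξ η) ≤
      (∫ ξ in (-(t - x))..(t + x), ∫ η in (-ξ)..(t - x), H ξ η) +
      1 / 4 * ∫ ξ in (-(t - x))..(t + x), ∫ η in (-ξ)..(t - x), E ξ η * ψ ξ η ^ (-γ - 1) := by
    have hi : ∀ f : ℝ → ℝ → ℝ, Continuous (fun z : ℝ × ℝ => f z.1 z.2) →
        Continuous fun ξ : ℝ => ∫ η in (-ξ)..(t - x), f ξ η := fun f hf => by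
      have e := intervalIntegral.continuous_parametric_intervalIntegral_of_continuous
        (μ := volume) (f := f) (a₀ := t - x) (s := fun ξ => -ξ) hf (by fun_prop)
      convert e.neg using 2
      exact intervalIntegral.integral_symm _ _
    have hs : ∀ f : ℝ → ℝ → ℝ, Continuous (fun z : ℝ × ℝ => f z.1 z.2) → ∀ ξ a b,
        IntervalIntegrable (fun η => f ξ η) volume a b := fun f hf ξ a b =>
      (hf.comp (by fun_prop : Continuous fun η => (ξ, η))).intervalIntegrable _ _
    have hsZ := hs (fun ξ η => E ξ η * ψ ξ η ^ (-γ - 1)) hZc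
    rw [← intervalIntegral.integral_const_mul, ← intervalIntegral.integral_const_mul,
      ← intervalIntegral.integral_add ((hi H hHc).intervalIntegrable _ _)
        (((hi _ hZc).const_mul _).intervalIntegrable _ _)]
    refine intervalIntegral.integral_mono_on (by linarith)
      (((hi V hVc).const_mul _).intervalIntegrable _ _)
      (((hi H hHc).add ((hi _ hZc).const_mul _)).intervalIntegrable _ _) fun ξ hξ => ?_
    rw [← intervalIntegral.integral_const_mul, ← intervalIntegral.integral_const_mul,
      ← intervalIntegral.integral_add (hs H hHc ξ _ _) ((hsZ ξ _ _).const_mul _)]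
    exact intervalIntegral.integral_mono_on (by linarith [hξ.1]) ((hs V hVc ξ _ _).const_mul _)
      ((hs H hHc ξ _ _).add ((hsZ ξ _ _).const_mul _)) fun η _ => hineq ξ η
  have hsource : ∀ q : ℝ, (waveKernel ⋆ₗ source q (barrier a γ c)) (t, x) =
      ENNReal.ofReal (1 / 4 * ∫ ξ in (-(t - x))..(t + x), ∫ η in (-ξ)..(t - x),
        E ξ η * (ψ ξ η ^ (-γ)) ^ q) := fun q => by
    have := waveKernel_lconvolution_ofReal
      (f := fun z => Real.exp (z.1 / 2) * barrier a γ c z ^ q)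
      (by
        refine Continuous.mul (by fun_prop) (Continuous.rpow_const (hbc _) fun z => Or.inl ?_)
        exact (Real.rpow_pos_of_pos (hΦ0 z) _).ne')
      (fun z => mul_nonneg (Real.exp_nonneg _)
        (Real.rpow_nonneg (Real.rpow_nonneg (hΦ0 z).le _) _)) ht.le x
    refine this.trans ?_
    simp only [barrier, hE, hψ, div_div]
    norm_num
  have hpow : ∀ ξ η, (ψ ξ η ^ (-γ)) ^ p = ψ ξ η ^ (-γ - 1) := fun ξ η => by
    rw [← Real.rpow_mul (hψ0 ξ η).le]
    congr 1
    linarith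
  have hg0 : ∀ y, 0 ≤ (a y ^ (-γ) - a y ^ (-γ - 1)) / 2 := fun y => by
    have := Real.rpow_le_rpow_of_exponent_le (h1 y) (by linarith : -γ - 1 ≤ -γ)
    linarith
  have e3 : V (t + x) (t - x) = Real.exp (t / 2) * barrier a γ c (t, x) := by
    have e1 : (t + x + (t - x)) / 4 = t / 2 := by ring
    have e2 : (t + x + (t - x)) / 2 = t := by ring
    have e3 : (t + x - (t - x)) / 2 = x := by ring
    simp only [hV, hE, hψ, barrier, e1, e2, e3]
  have e4 : V (-(t - x)) (t - x) = a (x - t) ^ (-γ) := by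
    have e1 : (-(t - x) - (t - x)) / 2 = x - t := by ring
    simp only [hV, hE, hψ, e1, neg_add_cancel, zero_div, Real.exp_zero, max_self, mul_zero,
      add_zero, one_mul]
  have n1 : ∀ y, 0 ≤ a y ^ (-γ) := fun y => Real.rpow_nonneg (hapos y).le _
  have n2 : 0 ≤ ∫ y in (x - t)..(x + t), (a y ^ (-γ) - a y ^ (-γ - 1)) / 2 :=
    intervalIntegral.integral_nonneg (by linarith) fun y _ => hg0 y
  have n3 : ∀ q : ℝ, 0 ≤ ∫ ξ in (-(t - x))..(t + x), ∫ η in (-ξ)..(t - x),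
      E ξ η * ψ ξ η ^ q := fun q =>
    intervalIntegral.integral_nonneg (by linarith) fun ξ hξ =>
      intervalIntegral.integral_nonneg (by linarith [hξ.1]) fun η _ =>
        mul_nonneg (Real.exp_nonneg _) (Real.rpow_nonneg (hψ0 ξ η).le _)
  have n4 := n3 (-γ)
  have n5 := n3 (-γ - 1)
  have h4 : (1 / 4 : ℝ≥0∞) = ENNReal.ofReal (1 / 4) := by
    rw [ENNReal.ofReal_div_of_pos (by norm_num)]; norm_num
  have h2 : (1 / 2 : ℝ≥0∞) = ENNReal.ofReal (1 / 2) := by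
    rw [ENNReal.ofReal_div_of_pos (by norm_num)]; norm_num
  rw [hsource, hsource]
  simp_rw [hpow, Real.rpow_one]
  have hgc : Continuous fun y => (a y ^ (-γ) - a y ^ (-γ - 1)) / 2 := by
    have := hac0 (-γ); have := hac0 (-γ - 1)
    fun_prop
  have n6 := n1 (x - t)
  have n7 := n1 (x + t)
  have n8 : 0 ≤ Real.exp (t / 2) * barrier a γ c (t, x) :=
    mul_nonneg (Real.exp_nonneg _) (Real.rpow_nonneg (hΦ0 _).le _)
  rw [dataConv_waveKernel_ofReal hgc hg0 ht.le, waveData, if_pos ht, h4, h2,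
    ← ENNReal.ofReal_add (n1 _) (n1 _), ← ENNReal.ofReal_mul (by norm_num),
    ← ENNReal.ofReal_mul (by norm_num), ← ENNReal.ofReal_add (by positivity) (by positivity),
    ← ENNReal.ofReal_add (by positivity) (by positivity),
    ← ENNReal.ofReal_add n8 (by positivity)]
  refine ENNReal.ofReal_le_ofReal ?_
  rw [hdal, hdata, e3, e4] at hint
  linarith

/-! ### The choice of the supersolution -/

/-- The profile `(Q + x²)^{m/2}` of the barrier in space. -/
noncomputable def profile (Q m x : ℝ) : ℝ := (Q + x ^ 2) ^ (m / 2)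

section Profile

variable {Q m : ℝ}

lemma hasDerivAt_add_sq_rpow (hQ : 1 ≤ Q) (r x : ℝ) :
    HasDerivAt (fun x : ℝ => (Q + x ^ 2) ^ r) (2 * x * r * (Q + x ^ 2) ^ (r - 1)) x := by
  have h : HasDerivAt (fun x : ℝ => Q + x ^ 2) (2 * x) x := by
    simpa using (hasDerivAt_pow 2 x).const_add Q
  exact h.rpow_const (Or.inl (by positivity))

lemma hasDerivAt_profile (hQ : 1 ≤ Q) (x : ℝ) :
    HasDerivAt (profile Q m) (m * (x * (Q + x ^ 2) ^ (m / 2 - 1))) x :=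
  (hasDerivAt_add_sq_rpow hQ (m / 2) x).congr_deriv (by ring)

lemma hasDerivAt_deriv_profile (hQ : 1 ≤ Q) (x : ℝ) :
    HasDerivAt (fun x => m * (x * (Q + x ^ 2) ^ (m / 2 - 1)))
      (m * ((Q + x ^ 2) ^ (m / 2 - 1) + (m - 2) * x ^ 2 * (Q + x ^ 2) ^ (m / 2 - 1 - 1))) x :=
  (((hasDerivAt_id x).mul (hasDerivAt_add_sq_rpow hQ (m / 2 - 1) x)).const_mul m).congr_deriv
    (by simp only [id]; ring)

lemma add_sq_rpow_le (hQ : 1 ≤ Q) (hm : m < 2) (x : ℝ) :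
    (Q + x ^ 2) ^ (m / 2 - 1) ≤ Q ^ (m / 2 - 1) :=
  Real.rpow_le_rpow_of_nonpos (by linarith) (by nlinarith) (by linarith)

lemma neg_le_deriv_deriv_profile (hQ : 1 ≤ Q) (hm0 : 0 < m) (hm : m < 2) (x : ℝ) :
    -Q ^ (m / 2 - 1) ≤
      m * ((Q + x ^ 2) ^ (m / 2 - 1) + (m - 2) * x ^ 2 * (Q + x ^ 2) ^ (m / 2 - 1 - 1)) := by
  have hB : 0 < Q + x ^ 2 := by positivity
  have h1 := add_sq_rpow_le hQ hm x
  have h2 : (Q + x ^ 2) ^ (m / 2 - 1) = (Q + x ^ 2) * (Q + x ^ 2) ^ (m / 2 - 1 - 1) := by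
    rw [Real.rpow_sub_one hB.ne' (m / 2 - 1), mul_div_cancel₀ _ hB.ne']
  have h3 : 0 < (Q + x ^ 2) ^ (m / 2 - 1 - 1) := Real.rpow_pos_of_pos hB _
  rw [h2] at h1 ⊢
  set B := Q + x ^ 2
  set R := B ^ (m / 2 - 1 - 1)
  have hx : x ^ 2 ≤ B := by simp only [B]; linarith
  have h4 : 0 ≤ (m * (2 - m)) * ((B - x ^ 2) * R) := by
    have : 0 ≤ B - x ^ 2 := by linarith
    have : 0 ≤ 2 - m := by linarith
    positivity
  have h5 : 0 ≤ (m - 1) ^ 2 * (B * R) := by positivity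
  have h6 : 0 ≤ m * (B * R) := by positivity
  nlinarith

lemma deriv_profile_sq_le (hQ : 1 ≤ Q) (hm0 : 0 < m) (hm : m < 2) (x : ℝ) :
    (m * (x * (Q + x ^ 2) ^ (m / 2 - 1))) ^ 2 ≤ 4 * Q ^ (m / 2 - 1) * profile Q m x := by
  have hB : 0 < Q + x ^ 2 := by positivity
  have h1 := add_sq_rpow_le hQ hm x
  have h2 : profile Q m x = (Q + x ^ 2) * (Q + x ^ 2) ^ (m / 2 - 1) := by
    rw [profile, Real.rpow_sub_one hB.ne' (m / 2), mul_div_cancel₀ _ hB.ne']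
  have h3 : 0 < (Q + x ^ 2) ^ (m / 2 - 1) := Real.rpow_pos_of_pos hB _
  rw [h2]
  set B := Q + x ^ 2
  set R := B ^ (m / 2 - 1)
  have hx : x ^ 2 ≤ B := by simp only [B]; linarith
  calc (m * (x * R)) ^ 2 = m ^ 2 * (x ^ 2 * (R * R)) := by ring
    _ ≤ 4 * (B * (R * Q ^ (m / 2 - 1))) := by
        gcongr
        nlinarith
    _ = _ := by ring

lemma rpow_le_profile (hQ : 1 ≤ Q) (hm0 : 0 < m) (x : ℝ) : Q ^ (m / 2) ≤ profile Q m x := by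
  unfold profile
  gcongr
  nlinarith

lemma abs_rpow_le_profile (hQ : 1 ≤ Q) (hm0 : 0 < m) (x : ℝ) : |x| ^ m ≤ profile Q m x := by
  have : |x| ^ m = (x ^ 2) ^ (m / 2) := by
    rw [← sq_abs, ← Real.rpow_natCast, ← Real.rpow_mul (abs_nonneg x)]
    congr 1
    push_cast
    ring
  rw [this, profile]
  gcongr
  linarith

/-- Both powers of `Q` are negative, so a large `Q` makes the barrier flat and small. -/
lemma exists_profile_parameter {γ p : ℝ} (hm0 : 0 < m) (hm : m < 2) :
    ∃ Q : ℝ, 1 ≤ Q ∧ 16 * (γ * (γ + 1)) * Q ^ (m / 2 - 1) ≤ 1 ∧ 4 * p * Q ^ (-(m / 2)) ≤ 1 := by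
  have h1 : Tendsto (fun Q : ℝ => 16 * (γ * (γ + 1)) * Q ^ (m / 2 - 1)) atTop
      (𝓝 (16 * (γ * (γ + 1)) * 0)) := by
    have := (tendsto_rpow_neg_atTop (y := 1 - m / 2) (by linarith)).const_mul
      (16 * (γ * (γ + 1)))
    simpa using this
  have h2 : Tendsto (fun Q : ℝ => 4 * p * Q ^ (-(m / 2))) atTop (𝓝 (4 * p * 0)) :=
    (tendsto_rpow_neg_atTop (by linarith)).const_mul _
  rw [mul_zero] at h1 h2
  obtain ⟨Q, hQ, hQ1, hQ2⟩ := ((eventually_ge_atTop 1).and ((h1.eventually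
    (Iic_mem_nhds one_pos)).and (h2.eventually (Iic_mem_nhds one_pos)))).exists
  exact ⟨Q, hQ, hQ1, hQ2⟩

end Profile

/-- `r / 4 - r ^ p` is nondecreasing on `[0, δ]` for small `δ`, by Bernoulli's inequality. -/
lemma rpow_sub_rpow_le {p δ : ℝ} (hp : 1 ≤ p) (hδ : 4 * p * δ ^ (p - 1) ≤ 1) {r s : ℝ}
    (hr : 0 ≤ r) (hrs : r ≤ s) (hsδ : s ≤ δ) : s ^ p - r ^ p ≤ (s - r) / 4 := by
  rcases hr.eq_or_lt with rfl | hr0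
  · rcases hrs.eq_or_lt with rfl | hs
    · simp
    · rw [Real.zero_rpow (by linarith)]
      have h1 : s ^ p = s * s ^ (p - 1) := by
        rw [Real.rpow_sub_one hs.ne', mul_div_cancel₀ _ hs.ne']
      have h2 : s ^ (p - 1) ≤ δ ^ (p - 1) := by gcongr
      have h3 : 0 ≤ δ ^ (p - 1) := Real.rpow_nonneg (by linarith) _
      have h4 : δ ^ (p - 1) ≤ 1 / 4 := by nlinarith
      rw [h1]
      nlinarith
  · have hs : 0 < s := by linarith
    have h1 : s ^ p = s * s ^ (p - 1) := by
      rw [Real.rpow_sub_one hs.ne', mul_div_cancel₀ _ hs.ne']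
    have h2 : s ^ (p - 1) ≤ δ ^ (p - 1) := by gcongr
    have h3 := one_add_mul_self_le_rpow_one_add (s := r / s - 1)
      (by have : 0 < r / s := by positivity
          linarith) hp
    rw [add_sub_cancel, Real.div_rpow hr hs.le, le_div_iff₀ (by positivity)] at h3
    have h4 : (1 + p * (r / s - 1)) * s ^ p = s ^ p - p * s ^ (p - 1) * (s - r) := by
      rw [h1]
      field_simp
      ring
    rw [h4] at h3
    have h5 : p * s ^ (p - 1) ≤ 1 / 4 := by nlinarith
    nlinarith

lemma exists_measurable_clamp {f A : ℝ → ℝ} (hf : AEMeasurable f) (hA : Measurable A)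
    (hA0 : ∀ y, 0 ≤ A y) (hfA : ∀ᵐ y, 0 ≤ f y ∧ f y ≤ A y) :
    ∃ g : ℝ → ℝ, Measurable g ∧ (∀ y, 0 ≤ g y) ∧ (∀ y, g y ≤ A y) ∧ f =ᵐ[volume] g := by
  have := hf.measurable_mk
  refine ⟨fun y => max 0 (min (hf.mk f y) (A y)), by fun_prop, fun y => le_max_left _ _,
    fun y => max_le (hA0 y) (min_le_right _ _), ?_⟩
  filter_upwards [hf.ae_eq_mk, hfA] with y h1 h2
  rw [← h1, min_eq_left h2.2, max_eq_right h2.1]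

lemma waveData_mono {f g : ℝ → ℝ≥0∞} (h : ∀ y, f y ≤ g y) (z : ℝ × ℝ) :
    waveData f z ≤ waveData g z := by
  unfold waveData
  split_ifs
  · gcongr <;> exact h _
  · exact le_rfl

lemma dataConv_mono {k : ℝ × ℝ → ℝ≥0∞} {f g : ℝ → ℝ≥0∞} (h : ∀ y, f y ≤ g y) (z : ℝ × ℝ) :
    dataConv k f z ≤ dataConv k g z :=
  lintegral_mono fun _ => mul_le_mul_right (h _) _

lemma bracket_rpow_le {Q ρ : ℝ} (hQ : 1 ≤ Q) (hρ : 0 < ρ) (x : ℝ) :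
    Q ^ (-ρ / 2) * bracket x ^ (-ρ) ≤ (Q + x ^ 2) ^ (-ρ / 2) := by
  have h1 : bracket x ^ (-ρ) = (1 + x ^ 2) ^ (-ρ / 2) := by
    rw [bracket, sq_abs, Real.sqrt_eq_rpow, ← Real.rpow_mul (by positivity)]
    congr 1
    ring
  rw [h1, ← Real.mul_rpow (by linarith) (by positivity)]
  refine Real.rpow_le_rpow_of_nonpos (by positivity) (by nlinarith [sq_nonneg x]) (by linarith)

/-- Mild solutions with small data lie below a fixed barrier. Only measurability and the pointwise
bounds of the data enter. -/
theorem exists_barrier {p ρ : ℝ} (hp : 1 < p) (hρ : 1 < ρ) (hρp : ρ < 2 / (p - 1)) :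
    ∃ Q : ℝ, 1 ≤ Q ∧ ∃ ε₀ : ℝ, 0 < ε₀ ∧ ∀ ε : ℝ, 0 < ε → ε ≤ ε₀ → ∀ u₀ u₁ : ℝ → ℝ,
      AEMeasurable u₀ → AEMeasurable u₁ →
      (∀ᵐ x : ℝ, 0 ≤ u₀ x ∧ u₀ x ≤ ε * bracket x ^ (-ρ)) →
      (∀ᵐ x : ℝ, 0 ≤ u₁ x + u₀ x / 2 ∧ u₁ x + u₀ x / 2 ≤ ε * bracket x ^ (-ρ)) →
      ∀ u : ℝ → ℝ → ℝ, IsMildSolution p u₀ u₁ u → ∀ t : ℝ, 0 < t →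
        AEStronglyMeasurable (u t) ∧ ∀ᵐ x : ℝ, u t x ≤
          barrier (profile Q (ρ * (p - 1))) (1 / (p - 1)) ((p - 1) / 2) (t, x) := by
  have hp1 : 0 < p - 1 := by linarith
  set m := ρ * (p - 1) with hm
  set γ := 1 / (p - 1) with hγ
  set c := (p - 1) / 2 with hc
  have hm0 : 0 < m := by positivity
  have hm2 : m < 2 := by rwa [lt_div_iff₀ hp1] at hρp
  have hγ0 : 0 < γ := by positivity
  have hγc : γ * c = 1 / 2 := by rw [hγ, hc]; field_simp
  have hγp : γ * p = γ + 1 := by rw [hγ]; field_simp; ring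
  have hγm : m / 2 * (-γ) = -ρ / 2 := by rw [hγ, hm]; field_simp
  obtain ⟨Q, hQ, hQ1, hQ2⟩ := exists_profile_parameter (γ := γ) (p := p) hm0 hm2
  have hQ0 : 0 < Q := by linarith
  -- this `ε₀` makes the data at most a quarter of the barrier, by `bracket_rpow_le`; the weighted
  -- velocity `(a^{-γ} - a^{-γ-1}) / 2` of the barrier is at least that quarter, because `a ≥ 2`
  refine ⟨Q, hQ, Q ^ (-ρ / 2) / 4, by positivity, ?_⟩
  intro ε hε hε0 u₀ u₁ hu₀ hu₁ hb₀ hb₁ u hu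
  set a := profile Q m with ha
  have hmid : 1 ≤ Q ^ (m / 2) := Real.one_le_rpow hQ (by linarith)
  have h1 : ∀ x, 1 ≤ a x := fun x => hmid.trans (rpow_le_profile hQ hm0 x)
  have hapos : ∀ x, 0 < a x := fun x => one_pos.trans_le (h1 x)
  have hac : Continuous a := continuous_iff_continuousAt.2 fun x =>
    (hasDerivAt_profile hQ x).continuousAt
  have haγ : ∀ x, a x ^ (-γ) = (Q + x ^ 2) ^ (-ρ / 2) := fun x => by
    rw [ha, profile, ← Real.rpow_mul (by positivity), hγm]
  have haγc : Continuous fun x => a x ^ (-γ) :=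
    hac.rpow_const fun x => Or.inl (hapos x).ne'
  have hdata : ∀ x, ε * bracket x ^ (-ρ) ≤ a x ^ (-γ) / 4 := fun x => by
    have h2 := bracket_rpow_le hQ (by linarith : 0 < ρ) x
    have h3 : 0 ≤ bracket x ^ (-ρ) := Real.rpow_nonneg (Real.sqrt_nonneg _) _
    rw [haγ]
    nlinarith
  have hA0 : ∀ y, 0 ≤ a y ^ (-γ) / 4 := fun y => by
    have := Real.rpow_nonneg (hapos y).le (-γ)
    positivity
  obtain ⟨f, hf, hf0, hfA, hfu⟩ := exists_measurable_clamp hu₀ (A := fun y => a y ^ (-γ) / 4)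
    (by have := haγc.measurable; fun_prop) hA0
    (hb₀.mono fun x hx => ⟨hx.1, hx.2.trans (hdata x)⟩)
  obtain ⟨g, hg, hg0, hgA, hgu⟩ := exists_measurable_clamp (hu₁.add (hu₀.div_const 2))
    (A := fun y => a y ^ (-γ) / 4) (by have := haγc.measurable; fun_prop) hA0
    (hb₁.mono fun x hx => ⟨hx.1, hx.2.trans (hdata x)⟩)
  have hA1 : ∀ y, a y ^ (-γ) ≤ 1 := fun y => Real.rpow_le_one_of_one_le_of_nonpos (h1 y)
    (by linarith)
  have hfM : ∀ y, f y ≤ 1 := fun y => by linarith [hfA y, hA1 y, hA0 y]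
  have hgM : ∀ y, g y ≤ 1 := fun y => by linarith [hgA y, hA1 y, hA0 y]
  obtain ⟨U, hU, hU0, hUu⟩ := hu.exists_measurable
  have hfin := hu.lconvolution_source_ne_top hUu
  have hE : ∀ t : ℝ, 0 < t → ∀ᵐ x : ℝ, ENNReal.ofReal (Real.exp (t / 2) * u t x) +
      (telegraphKernel ⋆ₗ source p U) (t, x) =
        telegraphData (fun y => ENNReal.ofReal (f y)) (t, x) +
          dataConv telegraphKernel (fun y => ENNReal.ofReal (g y)) (t, x) := fun t ht =>
    hu.duhamel hU hU0 hUu hf hg hf0 hg0 hfM hgM hfu hgu ht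
  intro t ht
  refine ⟨?_, ?_⟩
  · have hk := measurable_telegraphKernel
    have hm1 := measurable_lconvolution volume hk (measurable_source (p := p) hU)
    have hm2 := measurable_telegraphData (g := fun y => ENNReal.ofReal (f y)) (by fun_prop)
    have hm3 := measurable_dataConv (g := fun y => ENNReal.ofReal (g y)) hk (by fun_prop)
    have hmeas : Measurable fun x => Real.exp (-(t / 2)) *
        (telegraphData (fun y => ENNReal.ofReal (f y)) (t, x) +
          dataConv telegraphKernel (fun y => ENNReal.ofReal (g y)) (t, x) -
            (telegraphKernel ⋆ₗ source p U) (t, x)).toReal := by fun_prop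
    refine hmeas.aestronglyMeasurable.congr ?_
    filter_upwards [hE t ht, hu.nonneg t ht.le] with x hx hx0
    rw [← hx, ENNReal.add_sub_cancel_right (hfin t x), ENNReal.toReal_ofReal (by positivity),
      ← mul_assoc, ← Real.exp_add, neg_add_cancel, Real.exp_zero, one_mul]
  have hΦ : ∀ z : ℝ × ℝ, a z.2 ≤ a z.2 + c * max z.1 0 := fun z => by
    have := le_max_right z.1 0
    have : 0 ≤ c * max z.1 0 := by positivity
    linarith
  refine comparison (δ := (Q ^ (m / 2)) ^ (-γ)) hU (V := barrier a γ c) ?_ hU0 ?_ ?_ (by linarith)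
    ?_ hUu hfin (F := fun y => ENNReal.ofReal (f y)) (G := fun y => ENNReal.ofReal (g y))
    (by fun_prop) (by fun_prop) ENNReal.one_ne_top ?_ ?_ hE ?_ ht
  · have := hac.measurable
    unfold barrier
    fun_prop
  · exact fun z _ => Real.rpow_nonneg ((hapos _).le.trans (hΦ z)) _
  · exact fun z _ => Real.rpow_le_rpow_of_nonpos (by positivity)
      ((rpow_le_profile hQ hm0 z.2).trans (hΦ z)) (by linarith)
  · intro r s hr hrs hs
    refine rpow_sub_rpow_le hp.le ?_ hr hrs hs
    have : ((Q ^ (m / 2)) ^ (-γ)) ^ (p - 1) = Q ^ (-(m / 2)) := by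
      rw [← Real.rpow_mul hQ0.le, ← Real.rpow_mul hQ0.le]
      congr 1
      rw [hγ]
      field_simp
    rwa [this]
  · exact fun y => by simpa using hfM y
  · exact fun y => by simpa using hgM y
  · intro t x ht
    refine le_trans ?_ (barrier_supersolution (a := a) (hasDerivAt_profile hQ)
      (hasDerivAt_deriv_profile hQ) ?_ h1 hγ0 hγc ?_ ?_ hγp ht x)
    · refine add_le_add (add_le_add (waveData_mono (fun y => ?_) _)
        (dataConv_mono (fun y => ?_) _)) le_rfl
      · exact ENNReal.ofReal_le_ofReal (by linarith [hfA y, hA0 y])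
      · refine ENNReal.ofReal_le_ofReal ((hgA y).trans ?_)
        have h2 : a y ^ (-γ - 1) ≤ a y ^ (-γ) / 2 := by
          rw [Real.rpow_sub_one (hapos y).ne']
          have h3 : 0 ≤ a y ^ (-γ) := Real.rpow_nonneg (hapos y).le _
          have h4 : 2 ≤ a y := by
            refine le_trans ?_ (rpow_le_profile hQ hm0 y)
            rw [Real.rpow_neg hQ0.le, ← div_eq_mul_inv, div_le_one (by positivity)] at hQ2
            linarith
          gcongr
        linarith
    · have hB : ∀ x : ℝ, Q + x ^ 2 ≠ 0 := fun x => by positivity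
      have e1 : Continuous fun x : ℝ => (Q + x ^ 2) ^ (m / 2 - 1) :=
        Continuous.rpow_const (by fun_prop) fun x => Or.inl (hB x)
      have e2 : Continuous fun x : ℝ => (Q + x ^ 2) ^ (m / 2 - 1 - 1) :=
        Continuous.rpow_const (by fun_prop) fun x => Or.inl (hB x)
      fun_prop
    · intro x
      have e1 := neg_le_deriv_deriv_profile hQ hm0 hm2 x
      have e2 : 0 < Q ^ (m / 2 - 1) := by positivity
      have e3 : 0 ≤ γ * γ * Q ^ (m / 2 - 1) := by positivity
      nlinarith
    · intro x
      have e1 := deriv_profile_sq_le hQ hm0 hm2 x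
      have e2 := hapos x
      have e3 : 0 ≤ γ * (γ + 1) := by positivity
      calc γ * (γ + 1) * (m * (x * (Q + x ^ 2) ^ (m / 2 - 1))) ^ 2
          ≤ γ * (γ + 1) * (4 * Q ^ (m / 2 - 1) * a x) := by gcongr
        _ = 16 * (γ * (γ + 1)) * Q ^ (m / 2 - 1) * (a x / 4) := by ring
        _ ≤ 1 * (a x / 4) := by gcongr
        _ = a x / 4 := one_mul _

/-! ### Norms of the supersolution -/

lemma integrable_abs_rpow_add {m c γ : ℝ} (hm : 0 < m) (hc : 0 < c) (hγ : 0 < γ)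
    (hmγ : 1 < m * γ) : Integrable fun x : ℝ => (|x| ^ m + c) ^ (-γ) := by
  have hmin : 0 < min 1 c := lt_min one_pos hc
  set κ := min 1 c / 2 ^ m
  have hκ : 0 < κ := by positivity
  have h1 : Integrable fun x : ℝ => κ ^ (-γ) * (1 + ‖x‖) ^ (-(m * γ)) :=
    (integrable_one_add_norm (by simpa using hmγ)).const_mul _
  refine h1.mono' (Measurable.aestronglyMeasurable (by fun_prop)) (Eventually.of_forall fun x => ?_)
  have h0 : 0 ≤ |x| ^ m := Real.rpow_nonneg (abs_nonneg x) m
  have h2 : κ * (1 + |x|) ^ m ≤ |x| ^ m + c := by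
    have h3 : (1 + |x|) ^ m ≤ 2 ^ m * (|x| ^ m + 1) := by
      have h2m : (0 : ℝ) < 2 ^ m := by positivity
      rcases le_total 1 |x| with h | h
      · calc (1 + |x|) ^ m ≤ (2 * |x|) ^ m := by gcongr; linarith
          _ = 2 ^ m * |x| ^ m := Real.mul_rpow (by norm_num) (abs_nonneg x)
          _ ≤ _ := by gcongr; linarith
      · calc (1 + |x|) ^ m ≤ 2 ^ m := by gcongr; linarith
          _ ≤ _ := by nlinarith
    calc κ * (1 + |x|) ^ m ≤ κ * (2 ^ m * (|x| ^ m + 1)) := by gcongr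
      _ = min 1 c * |x| ^ m + min 1 c := by simp only [κ]; field_simp
      _ ≤ 1 * |x| ^ m + c := by
          gcongr
          · exact min_le_left _ _
          · exact min_le_right _ _
      _ = _ := by rw [one_mul]
  rw [Real.norm_of_nonneg (Real.rpow_nonneg (by linarith) _), neg_mul_eq_mul_neg,
    Real.rpow_mul (by positivity), ← Real.mul_rpow hκ.le (by positivity), Real.norm_eq_abs]
  exact Real.rpow_le_rpow_of_nonpos (by positivity) h2 (by linarith)

lemma lintegral_eq_mul_lintegral_comp_mul {f : ℝ → ℝ≥0∞} (hf : Measurable f) {s : ℝ}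
    (hs : 0 < s) : ∫⁻ x, f x = ENNReal.ofReal s * ∫⁻ x, f (s * x) := by
  have h1 := lintegral_map (μ := volume) hf (measurable_const_mul s)
  rw [Real.map_volume_mul_left hs.ne', lintegral_smul_measure, smul_eq_mul] at h1
  rw [← h1, ← mul_assoc, ← ENNReal.ofReal_mul hs.le, abs_of_pos (inv_pos.2 hs),
    mul_inv_cancel₀ hs.ne', ENNReal.ofReal_one, one_mul]

/-- The bound for the mass, by the scaling `x = t^{1/m} y`. -/
lemma exists_lintegral_abs_rpow_add_le {m c γ : ℝ} (hm : 0 < m) (hc : 0 < c) (hγ : 0 < γ)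
    (hmγ : 1 < m * γ) : ∃ K : ℝ, 0 ≤ K ∧ ∀ t : ℝ, 0 < t →
      ∫⁻ x : ℝ, ENNReal.ofReal ((|x| ^ m + c * t) ^ (-γ)) ≤
        ENNReal.ofReal (K * t ^ (1 / m - γ)) := by
  have hI := integrable_abs_rpow_add hm hc hγ hmγ
  have hnn : ∀ x : ℝ, 0 ≤ (|x| ^ m + c) ^ (-γ) := fun x => by positivity
  refine ⟨∫ x : ℝ, (|x| ^ m + c) ^ (-γ), integral_nonneg hnn, fun t ht => ?_⟩
  have hs : 0 < t ^ (1 / m) := by positivity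
  rw [lintegral_eq_mul_lintegral_comp_mul (by fun_prop) hs]
  have h1 : ∀ x : ℝ, ENNReal.ofReal ((|t ^ (1 / m) * x| ^ m + c * t) ^ (-γ)) =
      ENNReal.ofReal (t ^ (-γ)) * ENNReal.ofReal ((|x| ^ m + c) ^ (-γ)) := fun x => by
    rw [← ENNReal.ofReal_mul (by positivity), ← Real.mul_rpow ht.le (by positivity), abs_mul,
      Real.mul_rpow (abs_nonneg _) (abs_nonneg _), abs_of_pos hs, ← Real.rpow_mul ht.le,
      one_div_mul_cancel hm.ne', Real.rpow_one, mul_add, mul_comm c]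
  simp_rw [h1]
  rw [lintegral_const_mul' _ _ ENNReal.ofReal_ne_top, ← ofReal_integral_eq_lintegral_ofReal hI
    (Eventually.of_forall hnn), ← ENNReal.ofReal_mul (by positivity),
    ← ENNReal.ofReal_mul (by positivity), sub_eq_add_neg, Real.rpow_add ht]
  exact ENNReal.ofReal_le_ofReal (by linarith)

/-- Interpolation between the supremum and the `L¹` norm. -/
lemma eLpNorm_le_of_bound_of_lintegral_le {f : ℝ → ℝ} {A B : ℝ} (hA : 0 < A) (hB : 0 < B)
    (hf0 : ∀ᵐ x, 0 ≤ f x) (hfA : ∀ᵐ x, f x ≤ A)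
    (hfB : ∫⁻ x, ENNReal.ofReal (f x) ≤ ENNReal.ofReal B) {q : ℝ≥0∞} (hq : 1 ≤ q) :
    eLpNorm f q volume ≤ ENNReal.ofReal (A ^ (1 - q⁻¹.toReal) * B ^ q⁻¹.toReal) := by
  rcases eq_or_ne q ∞ with rfl | hqt
  · rw [ENNReal.inv_top, ENNReal.toReal_zero, sub_zero, Real.rpow_one, Real.rpow_zero, mul_one,
      eLpNorm_exponent_top]
    refine eLpNormEssSup_le_of_ae_bound ?_
    filter_upwards [hf0, hfA] with x h1 h2
    rwa [Real.norm_of_nonneg h1]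
  have hq0 : q ≠ 0 := (one_pos.trans_le hq).ne'
  have hr1 : 1 ≤ q.toReal := by
    rwa [← ENNReal.toReal_one, ENNReal.toReal_le_toReal ENNReal.one_ne_top hqt]
  rw [eLpNorm_eq_lintegral_rpow_enorm_toReal hq0 hqt, ENNReal.toReal_inv]
  set r := q.toReal
  have hr0 : 0 < r := by linarith
  have h1 : ∫⁻ x, ‖f x‖ₑ ^ r ≤ ENNReal.ofReal (A ^ (r - 1) * B) := by
    calc ∫⁻ x, ‖f x‖ₑ ^ r ≤ ∫⁻ x, ENNReal.ofReal (A ^ (r - 1)) * ENNReal.ofReal (f x) := by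
          refine lintegral_mono_ae ?_
          filter_upwards [hf0, hfA] with x h1 h2
          rw [Real.enorm_of_nonneg h1, ENNReal.ofReal_rpow_of_nonneg h1 hr0.le,
            ← ENNReal.ofReal_mul (by positivity)]
          refine ENNReal.ofReal_le_ofReal ?_
          rcases h1.eq_or_lt with h | h
          · rw [← h, Real.zero_rpow hr0.ne', mul_zero]
          · calc f x ^ r = f x ^ (r - 1) * f x := by
                  rw [Real.rpow_sub_one h.ne', div_mul_cancel₀ _ h.ne']
              _ ≤ A ^ (r - 1) * f x := by gcongr
      _ ≤ _ := by
          rw [lintegral_const_mul' _ _ ENNReal.ofReal_ne_top, ENNReal.ofReal_mul (by positivity)]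
          gcongr
  refine (ENNReal.rpow_le_rpow h1 (by positivity)).trans_eq ?_
  rw [ENNReal.ofReal_rpow_of_nonneg (by positivity) (by positivity),
    Real.mul_rpow (by positivity) hB.le, ← Real.rpow_mul hA.le, one_div]
  congr 3
  field_simp

/-- The integrand is the time derivative of `-2 (A + c t)^{-γ}`. -/
lemma lintegral_Ioi_add_mul_rpow {A c γ : ℝ} (hA : 0 < A) (hγ : 0 < γ)
    (hc : γ * c = 1 / 2) : ∫⁻ t in Ioi (0 : ℝ), ENNReal.ofReal ((A + c * t) ^ (-γ - 1)) =
      ENNReal.ofReal (2 * A ^ (-γ)) := by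
  have hc0 : 0 < c := by
    by_contra h
    nlinarith
  have hpos : ∀ t : ℝ, 0 ≤ t → 0 < A + c * t := fun t ht => by positivity
  have hd : ∀ t ∈ Ici (0 : ℝ), HasDerivAt (fun t => -2 * (A + c * t) ^ (-γ))
      ((A + c * t) ^ (-γ - 1)) t := fun t ht => by
    have e : HasDerivAt (fun t => A + c * t) c t := by
      simpa using ((hasDerivAt_id t).const_mul c).const_add A
    refine ((e.rpow_const (p := -γ) (Or.inl (hpos t ht).ne')).const_mul (-2)).congr_deriv ?_
    linear_combination 2 * (A + c * t) ^ (-γ - 1) * hc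
  have hg : ∀ t ∈ Ioi (0 : ℝ), 0 ≤ (A + c * t) ^ (-γ - 1) := fun t ht =>
    Real.rpow_nonneg (hpos t (le_of_lt ht)).le _
  have hl : Tendsto (fun t => -2 * (A + c * t) ^ (-γ)) atTop (𝓝 (-2 * 0)) := by
    refine Tendsto.const_mul _ ((tendsto_rpow_neg_atTop hγ).comp ?_)
    exact tendsto_atTop_add_const_left _ _ (tendsto_id.const_mul_atTop hc0)
  rw [← ofReal_integral_eq_lintegral_ofReal (integrableOn_Ioi_deriv_of_nonneg' hd hg hl)
    ((ae_restrict_mem measurableSet_Ioi).mono hg), integral_Ioi_of_hasDerivAt_of_nonneg' hd hg hl]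
  congr 1
  simp

lemma barrier_of_pos (a : ℝ → ℝ) (γ c : ℝ) {t : ℝ} (ht : 0 < t) (x : ℝ) :
    barrier a γ c (t, x) = (a x + c * t) ^ (-γ) := by
  rw [barrier, max_eq_left ht.le]

lemma memLp_of_le_barrier {p m γ c Q : ℝ} (hp : 1 < p) (hm : 0 < m) (hγ : 0 < γ)
    (hmγ : 1 < m * γ) (hγp : γ * p = γ + 1) (hc : γ * c = 1 / 2) (hQ : 1 ≤ Q)
    {u₀ u₁ : ℝ → ℝ} {u : ℝ → ℝ → ℝ} (hu : IsMildSolution p u₀ u₁ u)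
    (hle : ∀ t : ℝ, 0 < t → ∀ᵐ x : ℝ, u t x ≤ barrier (profile Q m) γ c (t, x)) :
    MemLp (fun z : ℝ × ℝ => u z.1 z.2) (ENNReal.ofReal p)
      ((volume.restrict (Ioi (0 : ℝ))).prod volume) := by
  have hmono : (volume.restrict (Ioi (0 : ℝ))).prod (volume : Measure ℝ) ≤
      (volume.restrict (Ici (0 : ℝ))).prod volume :=
    Measure.prod_mono (Measure.restrict_mono Ioi_subset_Ici_self le_rfl) le_rfl
  have hapos : ∀ x, 0 < profile Q m x := fun x =>
    (by positivity : 0 < Q ^ (m / 2)).trans_le (rpow_le_profile hQ hm x)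
  have hac : Continuous (profile Q m) := continuous_iff_continuousAt.2 fun x =>
    (hasDerivAt_profile hQ x).continuousAt
  have ham := hac.measurable
  have hc0 : 0 < c := by
    by_contra h
    nlinarith
  refine ⟨hu.measurable.mono_measure hmono, ?_⟩
  obtain ⟨U, hU, hU0, hUu⟩ := hu.exists_measurable
  have hUu' := ae_mono hmono hUu
  have hp0 : ENNReal.ofReal p ≠ 0 := by simpa using by linarith
  rw [eLpNorm_congr_ae hUu', eLpNorm_lt_top_iff_lintegral_rpow_enorm_lt_top hp0
    ENNReal.ofReal_ne_top, ENNReal.toReal_ofReal (by linarith)]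
  have h1 : ∫⁻ z, ‖U z‖ₑ ^ p ∂(volume.restrict (Ioi (0 : ℝ))).prod volume ≤
      ∫⁻ t in Ioi (0 : ℝ), ∫⁻ x, ENNReal.ofReal ((profile Q m x + c * t) ^ (-γ - 1)) := by
    rw [lintegral_prod _ (by fun_prop)]
    refine lintegral_mono_ae ?_
    filter_upwards [Measure.ae_ae_of_ae_prod hUu', ae_restrict_mem measurableSet_Ioi] with t h2 ht
    refine lintegral_mono_ae ?_
    filter_upwards [h2, hle t ht] with x h3 h4
    have ht0 : 0 < t := ht
    have hb : 0 < profile Q m x + c * t := by have := hapos x; positivity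
    rw [barrier_of_pos _ _ _ ht] at h4
    rw [← h3, Real.enorm_of_nonneg (h3.symm ▸ hU0 (t, x) : 0 ≤ u t x),
      ENNReal.ofReal_rpow_of_nonneg (h3.symm ▸ hU0 (t, x) : 0 ≤ u t x) (by linarith)]
    refine ENNReal.ofReal_le_ofReal ?_
    calc u t x ^ p ≤ ((profile Q m x + c * t) ^ (-γ)) ^ p := by
          have : 0 ≤ u t x := h3.symm ▸ hU0 (t, x)
          gcongr
      _ = _ := by
          rw [← Real.rpow_mul hb.le]
          congr 1
          linarith
  refine h1.trans_lt ?_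
  rw [lintegral_lintegral_swap (by fun_prop)]
  simp_rw [lintegral_Ioi_add_mul_rpow (hapos _) hγ hc]
  refine Integrable.lintegral_lt_top (Integrable.const_mul ?_ 2)
  have h2 : Integrable fun x : ℝ => (1 + ‖x‖ ^ 2) ^ (-(m * γ) / 2) :=
    integrable_rpow_neg_one_add_norm_sq (by simpa using hmγ)
  refine h2.mono' (Measurable.aestronglyMeasurable (by fun_prop)) (Eventually.of_forall fun x => ?_)
  rw [Real.norm_of_nonneg (Real.rpow_nonneg (hapos x).le _), profile,
    ← Real.rpow_mul (by positivity), Real.norm_eq_abs, sq_abs,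
    show m / 2 * -γ = -(m * γ) / 2 by ring]
  exact Real.rpow_le_rpow_of_nonpos (by positivity) (by linarith) (by nlinarith)

end DampedWave

theorem corollary1p2 (p ρ : ℝ) (hp : 1 < p) (hρ : 1 < ρ) (hρp : ρ < 2 / (p - 1)) :
    ∃ ε₀ : ℝ, 0 < ε₀ ∧ ∃ C : ℝ, 0 < C ∧
      ∀ ε : ℝ, 0 < ε → ε ≤ ε₀ →
      ∀ u₀ u₁ : ℝ → ℝ,
        DampedWave.MemW1 u₀ 1 → DampedWave.MemW1 u₀ ⊤ →
        MemLp u₁ 1 volume → MemLp u₁ ⊤ volume →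
        (∀ᵐ x : ℝ, 0 ≤ u₀ x ∧ u₀ x ≤ ε * DampedWave.bracket x ^ (-ρ)) →
        (∀ᵐ x : ℝ, 0 ≤ u₁ x + u₀ x / 2 ∧
          u₁ x + u₀ x / 2 ≤ ε * DampedWave.bracket x ^ (-ρ)) →
      ∀ u : ℝ → ℝ → ℝ, DampedWave.IsMildSolution p u₀ u₁ u →
        (∀ q : ENNReal, 1 ≤ q → ∀ t : ℝ, 0 < t →
          MemLp (u t) q volume ∧
          eLpNorm (u t) q volume ≤
            ENNReal.ofReal (C * t ^ ((q⁻¹).toReal * (1 / (ρ * (p - 1))) - 1 / (p - 1)))) ∧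
        MemLp (fun z : ℝ × ℝ => u z.1 z.2) (ENNReal.ofReal p)
          ((volume.restrict (Set.Ioi (0 : ℝ))).prod volume) := by
  have hp1 : 0 < p - 1 := by linarith
  obtain ⟨Q, hQ, ε₀, hε₀, hbar⟩ := DampedWave.exists_barrier hp hρ hρp
  set m := ρ * (p - 1) with hm
  set γ := 1 / (p - 1) with hγ
  set c := (p - 1) / 2 with hc
  have hm0 : 0 < m := by positivity
  have hγ0 : 0 < γ := by positivity
  have hc0 : 0 < c := by positivity
  have hγc : γ * c = 1 / 2 := by rw [hγ, hc]; field_simp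
  have hγp : γ * p = γ + 1 := by rw [hγ]; field_simp; ring
  have hmγ : 1 < m * γ := by
    have : m * γ = ρ := by rw [hm, hγ]; field_simp
    rwa [this]
  obtain ⟨K, hK, hint⟩ := DampedWave.exists_lintegral_abs_rpow_add_le hm0 hc0 hγ0 hmγ
  set C := c ^ (-γ) + K with hC
  have hcγ : 0 < c ^ (-γ) := Real.rpow_pos_of_pos hc0 _
  have hC0 : 0 < C := by positivity
  refine ⟨ε₀, hε₀, C, hC0, fun ε hε hεε u₀ u₁ h₀ _ h₁ _ hb₀ hb₁ u hu => ?_⟩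
  have hmain := hbar ε hε hεε u₀ u₁ h₀.1.aestronglyMeasurable.aemeasurable
    h₁.aestronglyMeasurable.aemeasurable hb₀ hb₁ u hu
  refine ⟨fun q hq t ht => ?_, DampedWave.memLp_of_le_barrier hp hm0 hγ0 hmγ hγp hγc hQ hu
    fun t ht => (hmain t ht).2⟩
  obtain ⟨hmeas, hle⟩ := hmain t ht
  have hle' : ∀ᵐ x : ℝ, u t x ≤ (|x| ^ m + c * t) ^ (-γ) := by
    filter_upwards [hle] with x hx
    refine hx.trans ?_
    rw [DampedWave.barrier_of_pos _ _ _ ht]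
    refine Real.rpow_le_rpow_of_nonpos (by positivity) ?_ (by linarith)
    have := DampedWave.abs_rpow_le_profile hQ hm0 x
    linarith
  have key := DampedWave.eLpNorm_le_of_bound_of_lintegral_le (f := u t) (A := C * t ^ (-γ))
    (B := C * t ^ (1 / m - γ)) (by positivity) (by positivity) (hu.nonneg t ht.le) (by
      filter_upwards [hle'] with x hx
      calc u t x ≤ (|x| ^ m + c * t) ^ (-γ) := hx
        _ ≤ (c * t) ^ (-γ) := Real.rpow_le_rpow_of_nonpos (by positivity)
            (by have : 0 ≤ |x| ^ m := by positivity
                linarith) (by linarith)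
        _ = c ^ (-γ) * t ^ (-γ) := Real.mul_rpow hc0.le ht.le
        _ ≤ C * t ^ (-γ) := by
            gcongr
            linarith) (by
      calc ∫⁻ x, ENNReal.ofReal (u t x)
          ≤ ∫⁻ x : ℝ, ENNReal.ofReal ((|x| ^ m + c * t) ^ (-γ)) :=
            lintegral_mono_ae (hle'.mono fun x hx => ENNReal.ofReal_le_ofReal hx)
        _ ≤ ENNReal.ofReal (K * t ^ (1 / m - γ)) := hint t ht
        _ ≤ _ := by
            refine ENNReal.ofReal_le_ofReal ?_
            gcongr
            linarith) hq
  have hexp : (C * t ^ (-γ)) ^ (1 - q⁻¹.toReal) * (C * t ^ (1 / m - γ)) ^ q⁻¹.toReal =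
      C * t ^ (q⁻¹.toReal * (1 / m) - γ) := by
    rw [Real.mul_rpow hC0.le (by positivity), Real.mul_rpow hC0.le (by positivity),
      ← Real.rpow_mul ht.le, ← Real.rpow_mul ht.le, mul_mul_mul_comm, ← Real.rpow_add hC0,
      ← Real.rpow_add ht, sub_add_cancel, Real.rpow_one]
    congr 2
    ring
  rw [hexp] at key
  exact ⟨⟨hmeas, key.trans_lt ENNReal.ofReal_lt_top⟩, key⟩
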